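/- **Conventions.** All groups are discrete. A *$*$-algebraic bundle* over a group $G$ is a family $\mathcal A=(A_t)_{t\in G}$ of complex vector spaces with an associative product that is bilinear $A_s\times A_t\to A_{st}$, and an involution that is conjugate linear $A_t\to A_{t^{-1}}$, with $(ab)^*=b^*a^*$ and $a^{**}=a$. A *$C^*$-norm* on it is a norm on each fiber such that $\|ab\|\le\|a\|\,\|b\|$, $\|a^*a\|=\|a\|^2$, and $a^*a\ge 0$ in the $C^*$-completion of $A_e$. If moreover all fibers are complete, $\mathcal A$ is a *Fell bundle*. If $\mathcal A$, $\mathcal B$ are Fell bundles over $G$, $H$, their algebraic tensor product $\mathcal A\odot\mathcal B$ is the $*$-algebraic bundle over $G\times H$ with fibers $A_t\odot B_s$ and operations $(a\odot b)(a'\odot b')=aa'\odot bb'$, $(a\odot b)^*=a^*\odot b^*$. A *tensor product* of $\mathcal A$ and $\mathcal B$ is the (fiberwise) completion of $\mathcal A\odot\mathcal B$ with respect to some $C^*$-norm; it is a Fell bundle over $G\times H$. A net $(a_i)_{i\in I}$ of finitely supported functions $a_i:G\to B_e$ is an *approximating net* for a Fell bundle $\mathcal B=(B_t)_{t\in G}$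 if $\sup_i\bigl\|\sum_{t\in G}a_i(t)^*a_i(t)\bigr\|<\infty$ and $\lim_i\sum_{r\in G}a_i(tr)^*\,b\,a_i(r)=b$ for all $t\in G$, $b\in B_t$. $\mathcal B$ has the *approximation property* if it has an approximating net. Let $\ell^2(\mathcal B)$ be the right Hilbert $B_e$-module of sections $\xi$ such that $\sum_t\xi(t)^*\xi(t)$ converges in norm, with $\langle\xi,\eta\rangle=\sum_t\xi(t)^*\eta(t)$; for $b\in B_t$ let $\Lambda(b)$ be the adjointable operator $(\Lambda(b)\xi)(s)=b\,\xi(t^{-1}s)$ on it. $C^*_r(\mathcal B)$ is the $C^*$-algebra of adjointable operators generated by all $\Lambda(b)$, and $C^*(\mathcal B)$ is the full cross-sectional $C^*$-algebra, generated by the image of the universal $*$-representation of $\mathcal B$ on Hilbert spaces. $\mathcal B$ is *amenable* if the left regular representation $\Lambda:C^*(\mathcal B)\to C^*_r(\mathcal B)$, the $*$-homomorphism extending $b\mapsto\Lambda(b)$, is an isomorphism. **Proposition.** Let $\mathcal A=(A_t)_{t\in G}$ and $\mathcal B=(B_s)_{s\in H}$ be Fell bundles over the discrete groups $G$ and $H$,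 and let $\mathcal C=\mathcal A\otimes\mathcal B$ be any tensor product of $\mathcal A$ and $\mathcal B$. 1. If $(\alpha_i)_{i\in I}$ is an approximating net for $\mathcal A$ and $(\beta_j)_{j\in J}$ is an approximating net for $\mathcal B$, then the functions $\gamma_{i,j}:G\times H\to C_e$, $\gamma_{i,j}(r,s)=\alpha_i(r)\otimes\beta_j(s)$, indexed by $I\times J$ with the product order, form an approximating net for $\mathcal C$. 2. Consequently, if $\mathcal A$ and $\mathcal B$ have the approximation property, then $\mathcal C$ has the approximation property, and $\mathcal C$ is amenable. -/

import Mathlib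

open scoped TensorProduct ENNReal ComplexConjugate

universe u u' v v' w w'

noncomputable section

/-! ### `*`-algebraic bundles, `C*`-norms and Fell bundles over a discrete group -/

/-- A `*`-algebraic bundle over the (discrete) group `G`. The product of the fibers over `s` and `t`
lands in the fiber over `s * t`; to avoid transporting along equalities of indices it is written
with values in the fiber over any `u` together with a proof of `s * t = u`. In the same way the
involution maps the fiber over `s` to the fiber over any `t` with `s⁻¹ = t`. -/
structure StarBundle (G : Type u) [Group G] where
  fiber : G → Type v
  [addCommGroup : ∀ t, AddCommGroup (fiber t)]
  [module : ∀ t, Module ℂ (fiber t)]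
  mul : ∀ {s t u : G}, s * t = u → (fiber s →ₗ[ℂ] fiber t →ₗ[ℂ] fiber u)
  star : ∀ {s t : G}, s⁻¹ = t → (fiber s →ₗ⋆[ℂ] fiber t)
  mul_assoc : ∀ {r s t p q x : G} (h₁ : r * s = p) (h₂ : p * t = x) (h₃ : s * t = q)
    (h₄ : r * q = x) (a : fiber r) (b : fiber s) (c : fiber t),
    mul h₂ (mul h₁ a b) c = mul h₄ a (mul h₃ b c)
  star_mul : ∀ {s t p s' t' p' : G} (h : s * t = p) (hp : p⁻¹ = p') (hs : s⁻¹ = s')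
    (ht : t⁻¹ = t') (h' : t' * s' = p') (a : fiber s) (b : fiber t),
    star hp (mul h a b) = mul h' (star ht b) (star hs a)
  star_star : ∀ {s t : G} (h : s⁻¹ = t) (h' : t⁻¹ = s) (a : fiber s), star h' (star h a) = a

attribute [instance] StarBundle.addCommGroup StarBundle.module

/-- A `C*`-norm on a `*`-algebraic bundle. The bundle with this norm is a pre-Fell bundle.
In `star_mul_self_nonneg`, an element of the unit fiber is positive in the `C*`-completion of the
unit fiber if and only if it is a norm limit of elements `c* c` with `c` in the unit fiber. -/
structure CStarNorm {G : Type u} [Group G] (A : StarBundle.{u, v} G) where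
  norm : ∀ {t : G}, A.fiber t → ℝ
  norm_nonneg : ∀ {t : G} (a : A.fiber t), 0 ≤ norm a
  eq_zero_of_norm : ∀ {t : G} (a : A.fiber t), norm a = 0 → a = 0
  norm_smul : ∀ {t : G} (z : ℂ) (a : A.fiber t), norm (z • a) = ‖z‖ * norm a
  norm_add_le : ∀ {t : G} (a b : A.fiber t), norm (a + b) ≤ norm a + norm b
  norm_mul_le : ∀ {s t p : G} (h : s * t = p) (a : A.fiber s) (b : A.fiber t),
    norm (A.mul h a b) ≤ norm a * norm b
  norm_star_mul_self : ∀ {t : G} (a : A.fiber t),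
    norm (A.mul (inv_mul_cancel t) (A.star rfl a) a) = norm a ^ 2
  star_mul_self_nonneg : ∀ {t : G} (a : A.fiber t), ∀ ε > 0, ∃ c : A.fiber 1,
    norm (A.mul (inv_mul_cancel t) (A.star rfl a) a
      - A.mul (one_mul 1) (A.star inv_one c) c) < ε

namespace CStarNorm

variable {G : Type u} [Group G] {A : StarBundle.{u, v} G} (α : CStarNorm A)

lemma core (t : G) : @NormedSpace.Core ℂ (A.fiber t) _ _ _ ⟨α.norm⟩ :=
  letI : Norm (A.fiber t) := ⟨α.norm⟩
  { norm_nonneg := α.norm_nonneg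
    norm_smul := α.norm_smul
    norm_triangle := α.norm_add_le
    norm_eq_zero_iff := fun x =>
      ⟨α.eq_zero_of_norm x, fun h => by simpa [h] using α.norm_smul (0 : ℂ) (0 : A.fiber t)⟩ }

/-- The fibers of a pre-Fell bundle as normed groups. -/
abbrev normedAddCommGroup (t : G) : NormedAddCommGroup (A.fiber t) :=
  letI : Norm (A.fiber t) := ⟨α.norm⟩
  NormedAddCommGroup.ofCore (α.core t)

end CStarNorm

/-- A Fell bundle over the discrete group `G`: a pre-Fell bundle all of whose fibers are
complete. -/
structure FellBundle (G : Type u) [Group G] extends StarBundle.{u, v} G where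
  cnorm : CStarNorm toStarBundle
  complete : ∀ t : G, @CompleteSpace (fiber t)
    (cnorm.normedAddCommGroup t).toPseudoMetricSpace.toUniformSpace

namespace FellBundle

variable {G : Type u} [Group G] (B : FellBundle.{u, v} G)

instance instNormedAddCommGroupFiber (t : G) : NormedAddCommGroup (B.fiber t) :=
  B.cnorm.normedAddCommGroup t

instance instNormedSpaceFiber (t : G) : NormedSpace ℂ (B.fiber t) :=
  letI : Norm (B.fiber t) := ⟨B.cnorm.norm⟩
  NormedSpace.ofCore (B.cnorm.core t)

instance instCompleteSpaceFiber (t : G) : CompleteSpace (B.fiber t) := B.complete t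

lemma norm_mul_le {s t p : G} (h : s * t = p) (a : B.fiber s) (b : B.fiber t) :
    ‖B.mul h a b‖ ≤ ‖a‖ * ‖b‖ := B.cnorm.norm_mul_le h a b

lemma norm_star_mul_self {t : G} (a : B.fiber t) :
    ‖B.mul (inv_mul_cancel t) (B.star rfl a) a‖ = ‖a‖ ^ 2 := B.cnorm.norm_star_mul_self a

lemma norm_star {s t : G} (h : s⁻¹ = t) (a : B.fiber s) : ‖B.star h a‖ = ‖a‖ := by
  have key : ∀ {s t : G} (h : s⁻¹ = t) (a : B.fiber s), ‖a‖ ≤ ‖B.star h a‖ := by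
    intro s t h a
    subst h
    rcases (norm_nonneg a).eq_or_lt with h0 | h0
    · rw [← h0]; exact norm_nonneg _
    · have := B.norm_mul_le (inv_mul_cancel s) (B.star rfl a) a
      rw [norm_star_mul_self, pow_two] at this
      exact le_of_mul_le_mul_right this h0
  refine le_antisymm ?_ (key h a)
  have h' : t⁻¹ = s := by rw [← h, inv_inv]
  simpa [B.star_star h h'] using key h' (B.star h a)

/-! ### The unit fiber is a `C*`-algebra -/

instance instNonUnitalCStarAlgebraUnitFiber : NonUnitalCStarAlgebra (B.fiber 1) :=
  { B.instNormedAddCommGroupFiber 1, B.instNormedSpaceFiber 1 with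
    mul := fun a b => B.mul (one_mul 1) a b
    left_distrib := fun a b c => map_add (B.mul (one_mul 1) a) b c
    right_distrib := fun a b c => by
      change B.mul (one_mul 1) (a + b) c = B.mul (one_mul 1) a c + B.mul (one_mul 1) b c
      simp
    zero_mul := fun a => by
      change B.mul (one_mul 1) 0 a = 0
      simp
    mul_zero := fun a => map_zero (B.mul (one_mul 1) a)
    mul_assoc := fun a b c => B.mul_assoc _ _ _ _ a b c
    norm_mul_le := fun a b => B.norm_mul_le _ a b
    star := fun a => B.star inv_one a
    star_involutive := fun a => B.star_star _ _ a
    star_mul := fun a b => B.star_mul _ _ _ _ _ a b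
    star_add := fun a b => map_add (B.star inv_one) a b
    complete := (B.instCompleteSpaceFiber 1).complete
    norm_mul_self_le := fun a => by
      have h : ∀ {t : G} (ht : (1 : G)⁻¹ = t) (h' : t * 1 = 1),
          ‖B.mul h' (B.star ht a) a‖ = ‖a‖ ^ 2 := by
        intro t ht h'
        subst ht
        exact B.norm_star_mul_self a
      rw [← pow_two]
      exact (h inv_one (one_mul 1)).ge
    smul_assoc := fun z a b => by
      change B.mul (one_mul 1) (z • a) b = z • B.mul (one_mul 1) a b
      simp
    smul_comm := fun z a b => ((B.mul (one_mul 1) a).map_smul z b).symm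
    star_smul := fun z a => (B.star inv_one).map_smulₛₗ z a }

/-- The usual order of the `C*`-algebra `B_e`. -/
instance instPartialOrderUnitFiber : PartialOrder (B.fiber 1) := CStarAlgebra.spectralOrder _

instance instStarOrderedRingUnitFiber : StarOrderedRing (B.fiber 1) :=
  CStarAlgebra.spectralOrderedRing _

lemma unit_mul_def (a b : B.fiber 1) : a * b = B.mul (one_mul 1) a b := rfl

lemma unit_star_def (a : B.fiber 1) : Star.star a = B.star inv_one a := rfl

end FellBundle
end
noncomputable section
namespace FellBundle

variable {G : Type u} [Group G] (B : FellBundle.{u, v} G)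

/-- The `B_e`-valued inner product `x* y` of two elements of the same fiber. -/
def ip {t : G} : B.fiber t →ₗ⋆[ℂ] B.fiber t →ₗ[ℂ] B.fiber 1 :=
  (B.mul (inv_mul_cancel t)).comp (B.star rfl)

lemma ip_apply {t : G} (x y : B.fiber t) :
    B.ip x y = B.mul (inv_mul_cancel t) (B.star rfl x) y := rfl

lemma star_ip {t : G} (x y : B.fiber t) : Star.star (B.ip x y) = B.ip y x := by
  rw [unit_star_def, ip_apply,
    B.star_mul _ inv_one (inv_inv t) rfl (inv_mul_cancel t), B.star_star]
  rfl

lemma ip_self_nonneg {t : G} (x : B.fiber t) : 0 ≤ B.ip x x := by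
  have hmem : B.ip x x ∈ closure {a : B.fiber 1 | 0 ≤ a} := by
    rw [Metric.mem_closure_iff]
    intro ε hε
    obtain ⟨c, hc⟩ := B.cnorm.star_mul_self_nonneg x ε hε
    refine ⟨Star.star c * c, star_mul_self_nonneg c, ?_⟩
    rw [dist_eq_norm]
    exact hc
  rwa [CStarAlgebra.isClosed_nonneg.closure_eq] at hmem

lemma norm_ip_self {t : G} (x : B.fiber t) : ‖B.ip x x‖ = ‖x‖ ^ 2 := B.norm_star_mul_self x

lemma ip_mul_right {t : G} (x y : B.fiber t) (a : B.fiber 1) :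
    B.ip x (B.mul (mul_one t) y a) = B.ip x y * a := by
  rw [ip_apply, ip_apply, unit_mul_def, B.mul_assoc]

/-- `⟨a x, y⟩ = ⟨x, a* y⟩`. -/
lemma ip_mul_left {s t r r' : G} (h : t * s = r) (h' : t⁻¹ = r') (h'' : r' * r = s)
    (a : B.fiber t) (x : B.fiber s) (y : B.fiber r) :
    B.ip (B.mul h a x) y = B.ip x (B.mul h'' (B.star h' a) y) := by
  subst h
  rw [ip_apply, ip_apply, B.star_mul rfl rfl h' rfl (by rw [← h', mul_inv_rev]), B.mul_assoc]

lemma ip_mul_self_le {s t r : G} (h : t * s = r) (a : B.fiber t) (x : B.fiber s) :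
    B.ip (B.mul h a x) (B.mul h a x) ≤ ‖a‖ ^ 2 • B.ip x x := by
  set c : B.fiber 1 := B.ip a a with hc
  have hsa : IsSelfAdjoint c := B.star_ip a a
  have hcn : ‖c‖ = ‖a‖ ^ 2 := B.norm_ip_self a
  -- `d = ‖a‖ - (‖a‖² - a* a) ^ (1/2)`, so that `(‖a‖ - d)² = ‖a‖² - a* a`
  let f : ℝ → ℝ := fun y => ‖a‖ - √(‖a‖ ^ 2 - y)
  have hf0 : f 0 = 0 := by simp [f]
  have hfc : Continuous f := by fun_prop
  set d : B.fiber 1 := cfcₙ f c with hd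
  have hdsa : Star.star d = d := cfcₙ_predicate f c
  have hdd : d * d = (2 * ‖a‖) • d - c := by
    conv_rhs => rw [← cfcₙ_id' ℝ c, hd, ← cfcₙ_smul (2 * ‖a‖) f c]
    rw [hd, ← cfcₙ_mul f f c, ← cfcₙ_sub (fun y => (2 * ‖a‖) • f y) (fun y => y) c
      (by fun_prop) (by simp [hf0])]
    refine cfcₙ_congr fun y hy => ?_
    have hy' : y ≤ ‖a‖ ^ 2 := by
      rw [← hcn]
      have hy2 := norm_apply_le_norm_cfcₙ (fun y : ℝ => y) c hy
      rw [cfcₙ_id' ℝ c] at hy2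
      exact (le_abs_self y).trans hy2
    have hs := Real.mul_self_sqrt (sub_nonneg.2 hy')
    simp only [f, smul_eq_mul]
    linear_combination hs
  have e1 : B.ip (B.mul h a x) (B.mul h a x) = B.ip x (B.mul (one_mul s) c x) := by
    have ht : t⁻¹ * r = s := by rw [← h, inv_mul_cancel_left]
    rw [B.ip_mul_left h rfl ht, hc, ip_apply B a a,
      B.mul_assoc (inv_mul_cancel t) (one_mul s) h ht]
  have e2 : ∀ y : B.fiber s, B.ip (B.mul (one_mul s) d x) y = B.ip x (B.mul (one_mul s) d y) :=
    fun y => by rw [B.ip_mul_left (one_mul s) inv_one (one_mul s), ← unit_star_def, hdsa]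
  have e3 : B.mul (one_mul s) d (B.mul (one_mul s) d x)
      = (2 * ‖a‖) • B.mul (one_mul s) d x - B.mul (one_mul s) c x := by
    rw [← B.mul_assoc (one_mul 1) (one_mul s), ← unit_mul_def, hdd]
    rw [map_sub, LinearMap.sub_apply, ← Complex.coe_smul, map_smul, LinearMap.smul_apply,
      Complex.coe_smul]
  have key := B.ip_self_nonneg (‖a‖ • x - B.mul (one_mul s) d x)
  have e4 : B.ip (‖a‖ • x - B.mul (one_mul s) d x) (‖a‖ • x - B.mul (one_mul s) d x)
      = ‖a‖ ^ 2 • B.ip x x - B.ip x (B.mul (one_mul s) c x) := by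
    simp only [← Complex.coe_smul] at e3 ⊢
    simp only [map_sub, LinearMap.sub_apply, map_smul, LinearMap.map_smulₛₗ, LinearMap.smul_apply,
      e2, e3, Complex.conj_ofReal]
    push_cast
    module
  rw [e4] at key
  rw [e1]
  exact sub_nonneg.1 key

lemma ip_add_self_le {t : G} (x y : B.fiber t) :
    B.ip (x + y) (x + y) ≤ (2 : ℝ) • B.ip x x + (2 : ℝ) • B.ip y y := by
  have h := B.ip_self_nonneg (x - y)
  have e : (2 : ℝ) • B.ip x x + (2 : ℝ) • B.ip y y - B.ip (x + y) (x + y)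
      = B.ip (x - y) (x - y) := by
    simp only [two_smul, map_add, map_sub, LinearMap.add_apply, LinearMap.sub_apply]
    abel
  rw [← sub_nonneg, e]
  exact h

end FellBundle

/-! ### Summability of positive families -/

lemma summable_of_nonneg_of_le_cstar {A : Type*} [NonUnitalCStarAlgebra A] [PartialOrder A]
    [StarOrderedRing A] {ι : Type*} {f g : ι → A} (h0 : ∀ i, 0 ≤ f i) (h : ∀ i, f i ≤ g i)
    (hg : Summable g) : Summable f := by
  rw [summable_iff_vanishing_norm] at hg ⊢
  intro ε hε
  obtain ⟨s, hs⟩ := hg ε hε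
  refine ⟨s, fun t ht => lt_of_le_of_lt ?_ (hs t ht)⟩
  exact CStarAlgebra.norm_le_norm_of_nonneg_of_le (Finset.sum_nonneg fun i _ => h0 i)
    (Finset.sum_le_sum fun i _ => h i)

namespace FellBundle

variable {G : Type u} [Group G] (B : FellBundle.{u, v} G)

/-! ### The Hilbert module `ℓ²(B)` -/

/-- The sections `ξ` of `B` such that `∑ ξ(t)* ξ(t)` converges in the norm of `B_e`. -/
def l2Submodule : Submodule ℂ (∀ t : G, B.fiber t) where
  carrier := {ξ | Summable fun t => B.ip (ξ t) (ξ t)}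
  zero_mem' := by
    have : (fun t : G => B.ip ((0 : ∀ t : G, B.fiber t) t) ((0 : ∀ t : G, B.fiber t) t))
        = fun _ => 0 := by
      funext _; simp
    simp only [Set.mem_ofPred_eq, this]
    exact summable_zero
  add_mem' := fun {ξ η} hξ hη =>
    summable_of_nonneg_of_le_cstar (fun t => B.ip_self_nonneg _)
      (fun t => B.ip_add_self_le (ξ t) (η t))
      ((Summable.const_smul (2 : ℝ) hξ).add (Summable.const_smul (2 : ℝ) hη))
  smul_mem' := fun z ξ hξ => by
    have : (fun t : G => B.ip ((z • ξ) t) ((z • ξ) t))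
        = fun t => (conj z * z) • B.ip (ξ t) (ξ t) := by
      funext t
      simp [smul_smul, mul_comm]
    simp only [Set.mem_ofPred_eq, this]
    exact Summable.const_smul _ hξ

/-- The right Hilbert `B_e`-module `ℓ²(B)`. -/
def L2 : Type (max u v) := B.l2Submodule

instance : AddCommGroup B.L2 := inferInstanceAs (AddCommGroup B.l2Submodule)
instance : Module ℂ B.L2 := inferInstanceAs (Module ℂ B.l2Submodule)

namespace L2
variable {B}

instance : CoeFun B.L2 (fun _ => ∀ t : G, B.fiber t) := ⟨fun ξ => ξ.1⟩

@[ext] lemma ext {ξ η : B.L2} (h : ∀ t, ξ t = η t) : ξ = η := Subtype.ext (funext h)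

@[simp] lemma add_apply (ξ η : B.L2) (t : G) : (ξ + η) t = ξ t + η t := rfl
@[simp] lemma sub_apply (ξ η : B.L2) (t : G) : (ξ - η) t = ξ t - η t := rfl
@[simp] lemma zero_apply (t : G) : (0 : B.L2) t = 0 := rfl
@[simp] lemma smul_apply (z : ℂ) (ξ : B.L2) (t : G) : (z • ξ) t = z • ξ t := rfl

lemma summable_self (ξ : B.L2) : Summable fun t => B.ip (ξ t) (ξ t) := ξ.2

lemma summable_ip (ξ η : B.L2) : Summable fun t => B.ip (ξ t) (η t) := by
  have h : (fun t => B.ip (ξ t) (η t)) = fun t => (4⁻¹ : ℂ) •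
      (B.ip ((ξ + η) t) ((ξ + η) t) - B.ip ((ξ - η) t) ((ξ - η) t)
      - Complex.I • B.ip ((ξ + Complex.I • η) t) ((ξ + Complex.I • η) t)
      + Complex.I • B.ip ((ξ - Complex.I • η) t) ((ξ - Complex.I • η) t)) := by
    funext t
    simp only [add_apply, sub_apply, smul_apply, map_add, map_sub, LinearMap.add_apply,
      LinearMap.sub_apply, map_smul, LinearMap.map_smulₛₗ, LinearMap.smul_apply, Complex.conj_I]
    match_scalars <;> ring_nf <;> norm_num [Complex.I_sq]
  rw [h]
  exact ((((summable_self _).sub (summable_self _)).sub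
    ((summable_self _).const_smul Complex.I)).add
    ((summable_self _).const_smul Complex.I)).const_smul _

/-- The inner product `⟨ξ, η⟩ = ∑ ξ(t)* η(t)` of `ℓ²(B)`. -/
def inner (ξ η : B.L2) : B.fiber 1 := ∑' t, B.ip (ξ t) (η t)

lemma inner_add_right (ξ η ζ : B.L2) : inner ξ (η + ζ) = inner ξ η + inner ξ ζ := by
  simp only [inner, add_apply, map_add]
  exact (summable_ip ξ η).tsum_add (summable_ip ξ ζ)

lemma inner_smul_right (z : ℂ) (ξ η : B.L2) : inner ξ (z • η) = z • inner ξ η := by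
  simp only [inner, smul_apply, map_smul]
  exact (summable_ip ξ η).tsum_const_smul z

lemma star_inner (ξ η : B.L2) : Star.star (inner ξ η) = inner η ξ := by
  simp only [inner, tsum_star, star_ip]

lemma inner_add_left (ξ η ζ : B.L2) : inner (ξ + η) ζ = inner ξ ζ + inner η ζ := by
  rw [← star_inner, inner_add_right, star_add, star_inner, star_inner]

lemma inner_smul_left (z : ℂ) (ξ η : B.L2) : inner (z • ξ) η = conj z • inner ξ η := by
  rw [← star_inner, inner_smul_right, star_smul, star_inner]
  rfl

lemma inner_self_nonneg (ξ : B.L2) : 0 ≤ inner ξ ξ := tsum_nonneg fun _ => B.ip_self_nonneg _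

lemma inner_self_eq_zero {ξ : B.L2} : inner ξ ξ = 0 ↔ ξ = 0 := by
  constructor
  · intro h
    ext t
    have h1 : B.ip (ξ t) (ξ t) ≤ 0 := by
      rw [← h]
      exact (summable_self ξ).le_tsum t fun j _ => B.ip_self_nonneg _
    have h2 := le_antisymm h1 (B.ip_self_nonneg _)
    have h3 := B.norm_ip_self (ξ t)
    rw [h2, norm_zero] at h3
    exact norm_eq_zero.1 (pow_eq_zero_iff two_ne_zero |>.1 h3.symm)
  · rintro rfl
    simp [inner]

/-- The right action of `B_e` on `ℓ²(B)`. -/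
def rmul (ξ : B.L2) (a : B.fiber 1) : B.L2 :=
  ⟨fun t => B.mul (mul_one t) (ξ t) a, by
    have : (fun t => B.ip (B.mul (mul_one t) (ξ t) a) (B.mul (mul_one t) (ξ t) a))
        = fun t => Star.star a * B.ip (ξ t) (ξ t) * a := by
      funext t
      rw [ip_mul_right, ← star_ip, ip_mul_right, star_mul, star_ip]
    change Summable fun t => B.ip (B.mul (mul_one t) (ξ t) a) (B.mul (mul_one t) (ξ t) a)
    rw [this]
    exact ((summable_self ξ).mul_left _).mul_right _⟩

lemma inner_rmul_right (ξ η : B.L2) (a : B.fiber 1) : inner ξ (rmul η a) = inner ξ η * a := by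
  simp only [inner]
  rw [← (summable_ip ξ η).tsum_mul_right a]
  exact tsum_congr fun _ => B.ip_mul_right _ _ _

/-- The norm `‖ξ‖ = ‖⟨ξ, ξ⟩‖ ^ (1/2)` of `ℓ²(B)`. -/
instance : Norm B.L2 := ⟨fun ξ => √‖inner ξ ξ‖⟩

lemma norm_sq (ξ : B.L2) : ‖ξ‖ ^ 2 = ‖inner ξ ξ‖ := Real.sq_sqrt (norm_nonneg _)

lemma norm_nonneg' (ξ : B.L2) : 0 ≤ ‖ξ‖ := Real.sqrt_nonneg _

lemma inner_mul_inner_le (ξ η : B.L2) :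
    inner η ξ * inner ξ η ≤ ‖ξ‖ ^ 2 • inner η η := by
  rcases eq_or_ne ξ 0 with rfl | h0
  · have h1 : ∀ ζ : B.L2, inner ζ 0 = 0 := fun ζ => by simp [inner]
    simp only [h1, zero_mul]
    exact smul_nonneg (sq_nonneg _) (inner_self_nonneg η)
  have hpos : 0 < ‖ξ‖ ^ 2 := by
    rw [norm_sq]
    exact norm_pos_iff.2 fun h => h0 (inner_self_eq_zero.1 h)
  set b := inner ξ η with hb
  have hb' : inner η ξ = Star.star b := (star_inner ξ η).symm
  set m : ℂ := ((‖ξ‖ ^ 2 : ℝ) : ℂ) with hm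
  have hmc : conj m = m := Complex.conj_ofReal _
  have hl : ∀ (ζ χ : B.L2) (a : B.fiber 1), inner (rmul ζ a) χ = Star.star a * inner ζ χ := by
    intro ζ χ a
    rw [← star_inner, inner_rmul_right, star_mul, star_inner]
  have key := inner_self_nonneg (rmul ξ b + (-m) • η)
  have e : inner (rmul ξ b + (-m) • η) (rmul ξ b + (-m) • η)
      = Star.star b * inner ξ ξ * b - (2 * m) • (Star.star b * b) + (m * m) • inner η η := by
    simp only [inner_add_left, inner_add_right, inner_smul_left, inner_smul_right, hl,
      inner_rmul_right, hb', map_neg, hmc, ← hb, add_mul, smul_mul_assoc, mul_assoc]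
    module
  have h1 : Star.star b * inner ξ ξ * b ≤ m • (Star.star b * b) := by
    rw [hm, Complex.coe_smul, norm_sq]
    exact CStarAlgebra.star_left_conjugate_le_norm_smul (star_inner ξ ξ)
  have h2 : 0 ≤ m • (m • inner η η - Star.star b * b) := by
    refine (key.trans_eq e).trans ?_
    have h3 : m • (m • inner η η - Star.star b * b) = m • (Star.star b * b)
        - (2 * m) • (Star.star b * b) + (m * m) • inner η η := by module
    rw [h3]
    gcongr
  have h4 : m • (m • inner η η - Star.star b * b)
      = ‖ξ‖ ^ 2 • (‖ξ‖ ^ 2 • inner η η - Star.star b * b) := by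
    rw [hm, Complex.coe_smul, Complex.coe_smul]
  rw [h4] at h2
  have h5 : 0 ≤ ‖ξ‖ ^ 2 • inner η η - Star.star b * b := by
    have := smul_nonneg (inv_nonneg.2 hpos.le) h2
    rwa [inv_smul_smul₀ hpos.ne'] at this
  rw [hb']
  exact sub_nonneg.1 h5

lemma norm_inner_le (ξ η : B.L2) : ‖inner ξ η‖ ≤ ‖ξ‖ * ‖η‖ := by
  have h := CStarAlgebra.norm_le_norm_of_nonneg_of_le
    (by rw [← star_inner ξ η]; exact star_mul_self_nonneg _) (inner_mul_inner_le ξ η)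
  rw [← star_inner ξ η, CStarRing.norm_star_mul_self, norm_smul, ← norm_sq η,
    Real.norm_of_nonneg (sq_nonneg _)] at h
  refine le_of_sq_le_sq ?_ (mul_nonneg (norm_nonneg' _) (norm_nonneg' _))
  rw [mul_pow, pow_two ‖inner ξ η‖]
  exact h

lemma core : NormedSpace.Core ℂ B.L2 where
  norm_nonneg := norm_nonneg'
  norm_smul z ξ := by
    refine (sq_eq_sq₀ (norm_nonneg' _) (mul_nonneg (norm_nonneg _) (norm_nonneg' _))).1 ?_
    rw [norm_sq, inner_smul_left, inner_smul_right, norm_smul, norm_smul, mul_pow, norm_sq,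
      RCLike.norm_conj]
    ring
  norm_triangle ξ η := by
    refine le_of_sq_le_sq ?_ (add_nonneg (norm_nonneg' _) (norm_nonneg' _))
    rw [norm_sq, inner_add_left, inner_add_right, inner_add_right]
    have h1 := norm_inner_le ξ η
    have h2 := norm_inner_le η ξ
    have h3 := norm_sq ξ
    have h4 := norm_sq η
    have h5 := norm_add_le (inner ξ ξ + inner ξ η) (inner η ξ + inner η η)
    have h6 := norm_add_le (inner ξ ξ) (inner ξ η)
    have h7 := norm_add_le (inner η ξ) (inner η η)
    nlinarith
  norm_eq_zero_iff ξ := by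
    rw [← inner_self_eq_zero, ← norm_eq_zero (a := inner ξ ξ), ← norm_sq]
    simp

instance : NormedAddCommGroup B.L2 := NormedAddCommGroup.ofCore core
instance : NormedSpace ℂ B.L2 := NormedSpace.ofCore core

end L2

/-! ### Adjointable operators on `ℓ²(B)` -/

/-- The algebra of adjointable operators on the Hilbert module `ℓ²(B)`, with the operator norm. -/
def adjointable : Subalgebra ℂ (B.L2 →L[ℂ] B.L2) where
  carrier := {T | ∃ S : B.L2 →L[ℂ] B.L2, ∀ ξ η, L2.inner (T ξ) η = L2.inner ξ (S η)}
  mul_mem' := by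
    rintro T T' ⟨S, hS⟩ ⟨S', hS'⟩
    exact ⟨S' * S, fun ξ η => by
      simp only [mul_apply_eq_comp]
      rw [hS, hS']⟩
  add_mem' := by
    rintro T T' ⟨S, hS⟩ ⟨S', hS'⟩
    exact ⟨S + S', fun ξ η => by
      simp only [add_apply, L2.inner_add_left, L2.inner_add_right, hS, hS']⟩
  algebraMap_mem' := fun z => ⟨algebraMap ℂ _ (conj z), fun ξ η => by
    simp only [Algebra.algebraMap_eq_smul_one, smul_apply,
      one_apply_eq_self, L2.inner_smul_left, L2.inner_smul_right]⟩

namespace adjointable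
variable {B}

/-- The adjoint of an adjointable operator. -/
def adj (T : B.adjointable) : B.L2 →L[ℂ] B.L2 := Classical.choose T.2

lemma inner_adj (T : B.adjointable) (ξ η : B.L2) :
    L2.inner (T.1 ξ) η = L2.inner ξ (adj T η) := Classical.choose_spec T.2 ξ η

lemma inner_adj' (T : B.adjointable) (ξ η : B.L2) :
    L2.inner (adj T ξ) η = L2.inner ξ (T.1 η) := by
  rw [← L2.star_inner, ← inner_adj, L2.star_inner]

lemma adj_unique (T : B.adjointable) (S : B.L2 →L[ℂ] B.L2)
    (h : ∀ ξ η, L2.inner (T.1 ξ) η = L2.inner ξ (S η)) : adj T = S := by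
  ext1 η
  rw [← sub_eq_zero, ← L2.inner_self_eq_zero]
  have key : ∀ ξ, L2.inner ξ (adj T η - S η) = 0 := fun ξ => by
    rw [sub_eq_add_neg, ← neg_one_smul ℂ, L2.inner_add_right, L2.inner_smul_right,
      ← inner_adj, ← h]
    simp
  exact key _

instance : Star B.adjointable := ⟨fun T => ⟨adj T, T.1, inner_adj' T⟩⟩

lemma coe_star (T : B.adjointable) : (Star.star T).1 = adj T := rfl

/-- The defining property `⟨T ξ, η⟩ = ⟨ξ, T* η⟩` of the involution. -/
lemma inner_star (T : B.adjointable) (ξ η : B.L2) :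
    L2.inner (T.1 ξ) η = L2.inner ξ ((Star.star T).1 η) := inner_adj T ξ η

instance : StarRing B.adjointable where
  star_involutive T := Subtype.ext (adj_unique _ _ (inner_adj' T))
  star_mul T S := Subtype.ext (adj_unique _ _ fun ξ η => by
    change L2.inner (T.1 (S.1 ξ)) η = L2.inner ξ (adj S (adj T η))
    rw [inner_adj, inner_adj])
  star_add T S := Subtype.ext (adj_unique _ _ fun ξ η => by
    change L2.inner (T.1 ξ + S.1 ξ) η = L2.inner ξ (adj T η + adj S η)
    rw [L2.inner_add_left, L2.inner_add_right, inner_adj, inner_adj])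

instance : StarModule ℂ B.adjointable where
  star_smul z T := Subtype.ext (adj_unique _ _ fun ξ η => by
    change L2.inner (z • T.1 ξ) η = L2.inner ξ (conj z • adj T η)
    rw [L2.inner_smul_left, L2.inner_smul_right, inner_adj])

lemma norm_star_le (T : B.adjointable) : ‖Star.star T‖ ≤ ‖T‖ := by
  refine ContinuousLinearMap.opNorm_le_bound _ (norm_nonneg _) fun ξ => ?_
  change ‖adj T ξ‖ ≤ ‖T‖ * ‖ξ‖
  have h : ‖adj T ξ‖ ^ 2 ≤ ‖T‖ * ‖adj T ξ‖ * ‖ξ‖ := by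
    rw [L2.norm_sq, ← inner_adj]
    refine (L2.norm_inner_le _ _).trans ?_
    gcongr
    exact ContinuousLinearMap.le_opNorm T.1 _
  rcases (norm_nonneg (adj T ξ)).eq_or_lt with h0 | h0
  · rw [← h0]; positivity
  · nlinarith

instance : ContinuousStar B.adjointable where
  continuous_star := by
    have : Isometry (Star.star : B.adjointable → B.adjointable) :=
      AddMonoidHomClass.isometry_of_norm (starAddEquiv : B.adjointable ≃+ B.adjointable)
        fun T => le_antisymm (norm_star_le T) (by
          have h := norm_star_le (Star.star T)
          rw [star_star] at h
          exact h)
    exact this.continuous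

end adjointable

/-! ### The left regular representation and the reduced cross-sectional algebra -/

/-- For `b` in the fiber over `t`, the operator `(Λ(b) ξ)(s) = b ξ(t⁻¹ s)` on `ℓ²(B)`. -/
def regularOp {t : G} (b : B.fiber t) : B.L2 →L[ℂ] B.L2 :=
  LinearMap.mkContinuous
    { toFun := fun ξ => ⟨fun s => B.mul (mul_inv_cancel_left t s) b (ξ (t⁻¹ * s)), by
        refine summable_of_nonneg_of_le_cstar (fun s => B.ip_self_nonneg _)
          (fun s => B.ip_mul_self_le (mul_inv_cancel_left t s) b (ξ (t⁻¹ * s))) ?_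
        exact ((Equiv.mulLeft t⁻¹).summable_iff.2 (L2.summable_self ξ)).const_smul (‖b‖ ^ 2)⟩
      map_add' := fun ξ η => by
        ext s
        exact map_add (B.mul (mul_inv_cancel_left t s) b) _ _
      map_smul' := fun z ξ => by
        ext s
        exact map_smul (B.mul (mul_inv_cancel_left t s) b) _ _ }
    ‖b‖ (fun ξ => by
      refine le_of_sq_le_sq ?_ (by positivity)
      have hle : ∑' s, B.ip (B.mul (mul_inv_cancel_left t s) b (ξ (t⁻¹ * s)))
          (B.mul (mul_inv_cancel_left t s) b (ξ (t⁻¹ * s))) ≤ ‖b‖ ^ 2 • L2.inner ξ ξ := by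
        have hs : Summable fun s => B.ip (ξ (t⁻¹ * s)) (ξ (t⁻¹ * s)) :=
          (Equiv.mulLeft t⁻¹).summable_iff.2 (L2.summable_self ξ)
        have he : ∑' s, B.ip (ξ (t⁻¹ * s)) (ξ (t⁻¹ * s)) = L2.inner ξ ξ :=
          (Equiv.mulLeft t⁻¹).tsum_eq fun s => B.ip (ξ s) (ξ s)
        rw [← he, ← hs.tsum_const_smul]
        refine Summable.tsum_le_tsum
          (fun s => B.ip_mul_self_le (mul_inv_cancel_left t s) b (ξ (t⁻¹ * s))) ?_
          (hs.const_smul _)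
        exact summable_of_nonneg_of_le_cstar (fun s => B.ip_self_nonneg _)
          (fun s => B.ip_mul_self_le (mul_inv_cancel_left t s) b (ξ (t⁻¹ * s)))
          (hs.const_smul _)
      have h := CStarAlgebra.norm_le_norm_of_nonneg_of_le
        (tsum_nonneg fun s => B.ip_self_nonneg _) hle
      rw [norm_smul, Real.norm_of_nonneg (sq_nonneg _), ← L2.norm_sq, ← mul_pow] at h
      rw [L2.norm_sq]
      exact h)

@[simp] lemma regularOp_apply {t : G} (b : B.fiber t) (ξ : B.L2) (s : G) :
    B.regularOp b ξ s = B.mul (mul_inv_cancel_left t s) b (ξ (t⁻¹ * s)) := rfl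

lemma inner_regularOp {t : G} (b : B.fiber t) (ξ η : B.L2) :
    L2.inner (B.regularOp b ξ) η = L2.inner ξ (B.regularOp (B.star rfl b) η) := by
  simp only [L2.inner, regularOp_apply]
  rw [← (Equiv.mulLeft t).tsum_eq]
  refine tsum_congr fun s => ?_
  simp only [Equiv.coe_mulLeft]
  have hx : ∀ (p q : G) (hp : t * p = t * s) (hq : t⁻¹ * q = s) (_ : p = s) (_ : q = t * s),
      B.ip (B.mul hp b (ξ p)) (η (t * s)) = B.ip (ξ s) (B.mul hq (B.star rfl b) (η q)) := by
    intro p q hp hq h1 h2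
    subst h1 h2
    exact B.ip_mul_left _ _ _ _ _ _
  exact hx _ _ _ _ (inv_mul_cancel_left t s) (by rw [inv_inv])

/-- The left regular representation, as adjointable operators on `ℓ²(B)`. -/
def regular {t : G} (b : B.fiber t) : B.adjointable :=
  ⟨B.regularOp b, B.regularOp (B.star rfl b), B.inner_regularOp b⟩

/-- The reduced cross-sectional `C*`-algebra `C*_r(B)`: the `C*`-algebra of adjointable operators on
`ℓ²(B)` generated by the operators `Λ(b)`. -/
def reducedAlgebra : NonUnitalStarSubalgebra ℂ B.adjointable :=
  (NonUnitalStarAlgebra.adjoin ℂ {T | ∃ (t : G) (b : B.fiber t), T = B.regular b}).topologicalClosure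

lemma regular_mem {t : G} (b : B.fiber t) : B.regular b ∈ B.reducedAlgebra :=
  NonUnitalStarSubalgebra.le_topologicalClosure _
    (NonUnitalStarAlgebra.subset_adjoin ℂ _ ⟨t, b, rfl⟩)

/-! ### The full cross-sectional algebra -/

/-- A `*`-representation of the Fell bundle `B` on a Hilbert space. Every cyclic representation of
`B` lives, up to unitary equivalence, on a Hilbert space in the universe used here. -/
structure Rep where
  H : Type (max u v)
  [normedAddCommGroup : NormedAddCommGroup H]
  [innerProductSpace : InnerProductSpace ℂ H]
  [completeSpace : CompleteSpace H]
  toFun : ∀ {t : G}, B.fiber t →ₗ[ℂ] (H →L[ℂ] H)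
  map_mul : ∀ {s t p : G} (h : s * t = p) (a : B.fiber s) (b : B.fiber t),
    toFun (B.mul h a b) = toFun a * toFun b
  map_star : ∀ {s t : G} (h : s⁻¹ = t) (a : B.fiber s),
    toFun (B.star h a) = Star.star (toFun a)

attribute [instance] Rep.normedAddCommGroup Rep.innerProductSpace Rep.completeSpace

lemma Rep.norm_le {B : FellBundle.{u, v} G} (π : B.Rep) {t : G} (b : B.fiber t) :
    ‖π.toFun b‖ ≤ ‖b‖ := by
  let φ : B.fiber 1 →⋆ₙₐ[ℂ] (π.H →L[ℂ] π.H) :=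
    { toFun := fun a => π.toFun a
      map_smul' := fun z a => map_smul _ z a
      map_zero' := map_zero _
      map_add' := fun a b => map_add _ a b
      map_mul' := fun a b => π.map_mul _ a b
      map_star' := fun a => π.map_star _ a }
  have h := NonUnitalStarAlgHom.norm_apply_le φ (B.ip b b)
  have h2 : φ (B.ip b b) = Star.star (π.toFun b) * π.toFun b := by
    change π.toFun (B.ip b b) = _
    rw [ip_apply, π.map_mul, π.map_star]
  rw [h2, CStarRing.norm_star_mul_self, norm_ip_self, ← pow_two] at h
  exact le_of_sq_le_sq h (norm_nonneg _)

/-- The `C*`-algebra of bounded families of operators, one for each representation of `B`, with the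
supremum norm and pointwise operations. -/
abbrev UniversalAlgebra := lp (fun π : B.Rep => π.H →L[ℂ] π.H) ∞

/-- The universal representation of `B`. -/
def universal {t : G} (b : B.fiber t) : B.UniversalAlgebra :=
  ⟨fun π => π.toFun b, memℓp_infty ⟨‖b‖, by rintro _ ⟨π, rfl⟩; exact π.norm_le b⟩⟩

/-- The full cross-sectional `C*`-algebra `C*(B)`: the `C*`-algebra generated by the image of the
universal representation of `B`, i.e. the completion of the finitely supported sections in the
largest `C*`-norm coming from representations of `B`. -/
def fullAlgebra : NonUnitalStarSubalgebra ℂ B.UniversalAlgebra :=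
  (NonUnitalStarAlgebra.adjoin ℂ {x | ∃ (t : G) (b : B.fiber t), x = B.universal b}).topologicalClosure

lemma universal_mem {t : G} (b : B.fiber t) : B.universal b ∈ B.fullAlgebra :=
  NonUnitalStarSubalgebra.le_topologicalClosure _
    (NonUnitalStarAlgebra.subset_adjoin ℂ _ ⟨t, b, rfl⟩)

/-- The Fell bundle `B` is amenable: the left regular representation
`Λ : C*(B) → C*_r(B)`, the unique `*`-homomorphism extending `b ↦ Λ(b)`, is an isomorphism. -/
def IsAmenable : Prop :=
  ∃ Λ : B.fullAlgebra →⋆ₙₐ[ℂ] B.reducedAlgebra,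
    (∀ (t : G) (b : B.fiber t), Λ ⟨B.universal b, B.universal_mem b⟩ = ⟨B.regular b, B.regular_mem b⟩) ∧
    Function.Bijective Λ

/-! ### The approximation property -/

/-- The net `(a i)` of finitely supported functions `G → B_e` is an approximating net for `B`. -/
structure IsApproximatingNet {I : Type w} [Preorder I] (a : I → G →₀ B.fiber 1) : Prop where
  bounded : ∃ M : ℝ, ∀ i, ‖(a i).sum fun _ x => Star.star x * x‖ ≤ M
  tendsto : ∀ (t : G) (b : B.fiber t),
    Filter.Tendsto
      (fun i => (a i).sum fun r x =>
        B.mul (mul_one t) (B.mul (one_mul t) (Star.star (a i (t * r))) b) x)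
      Filter.atTop (nhds b)

/-- The approximation property of a Fell bundle. The index set ranges over the directed sets in the
universe of `B`; larger universes give the same notion. -/
def HasApproximationProperty : Prop :=
  ∃ (I : Type (max u v)) (_ : Preorder I) (_ : IsDirectedOrder I) (_ : Nonempty I)
    (a : I → G →₀ B.fiber 1), B.IsApproximatingNet a

end FellBundle

/-! ### Tensor products -/

namespace StarBundle

variable {G : Type u} [Group G] {H : Type u'} [Group H]

/-- The algebraic tensor product of two `*`-algebraic bundles: the bundle over `G × H` with fibers
`A_t ⊙ B_s`, product `(a ⊙ b) (a' ⊙ b') = a a' ⊙ b b'` and involution `(a ⊙ b)* = a* ⊙ b*`. -/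
def algTensor (A : StarBundle.{u, v} G) (B : StarBundle.{u', v'} H) :
    StarBundle.{max u u', max v v'} (G × H) where
  fiber p := A.fiber p.1 ⊗[ℂ] B.fiber p.2
  mul h := TensorProduct.map₂ (A.mul (congrArg Prod.fst h)) (B.mul (congrArg Prod.snd h))
  star h := TensorProduct.map (A.star (congrArg Prod.fst h)) (B.star (congrArg Prod.snd h))
  mul_assoc h₁ h₂ h₃ h₄ x y z := by
    induction x with
    | zero => simp
    | add x x' hx hx' => simp only [map_add, LinearMap.add_apply, hx, hx']
    | tmul a b =>
      induction y with
      | zero => simp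
      | add y y' hy hy' => simp only [map_add, LinearMap.add_apply, hy, hy']
      | tmul a' b' =>
        induction z with
        | zero => simp
        | add z z' hz hz' => simp only [map_add, hz, hz']
        | tmul a'' b'' =>
          simp only [TensorProduct.map₂_apply_tmul, TensorProduct.map_tmul]
          rw [A.mul_assoc _ _ (congrArg Prod.fst h₃) (congrArg Prod.fst h₄),
            B.mul_assoc _ _ (congrArg Prod.snd h₃) (congrArg Prod.snd h₄)]
  star_mul h hp hs ht h' x y := by
    induction x with
    | zero => simp
    | add x x' hx hx' => simp only [map_add, LinearMap.add_apply, hx, hx']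
    | tmul a b =>
      induction y with
      | zero => simp
      | add y y' hy hy' => simp only [map_add, LinearMap.add_apply, hy, hy']
      | tmul a' b' =>
        simp only [TensorProduct.map₂_apply_tmul, TensorProduct.map_tmul]
        rw [A.star_mul _ _ (congrArg Prod.fst hs) (congrArg Prod.fst ht) (congrArg Prod.fst h'),
          B.star_mul _ _ (congrArg Prod.snd hs) (congrArg Prod.snd ht) (congrArg Prod.snd h')]
  star_star h h' x := by
    induction x with
    | zero => simp
    | add x x' hx hx' => simp only [map_add, hx, hx']
    | tmul a b => simp only [TensorProduct.map_tmul, A.star_star, B.star_star]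

end StarBundle

/-- A completion of the pre-Fell bundle `(A, α)`: a Fell bundle over the same group together with an
isometric morphism of `*`-algebraic bundles from `A` with dense range in every fiber. -/
structure CStarNorm.Completion {G : Type u} [Group G] {A : StarBundle.{u, v} G} (α : CStarNorm A)
    where
  bundle : FellBundle.{u, v} G
  ι : ∀ {t : G}, A.fiber t →ₗ[ℂ] bundle.fiber t
  map_mul : ∀ {s t p : G} (h : s * t = p) (a : A.fiber s) (b : A.fiber t),
    ι (A.mul h a b) = bundle.mul h (ι a) (ι b)
  map_star : ∀ {s t : G} (h : s⁻¹ = t) (a : A.fiber s), ι (A.star h a) = bundle.star h (ι a)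
  norm_map : ∀ {t : G} (a : A.fiber t), ‖ι a‖ = α.norm a
  dense : ∀ t : G, DenseRange (ι (t := t))

namespace FellBundle

variable {G : Type u} [Group G] {H : Type u'} [Group H]

/-- The algebraic tensor product `A ⊙ B` of two Fell bundles. -/
abbrev algTensor (A : FellBundle.{u, v} G) (B : FellBundle.{u', v'} H) :
    StarBundle.{max u u', max v v'} (G × H) :=
  A.toStarBundle.algTensor B.toStarBundle

/-- For a completion `C` of `A ⊙ B` and finitely supported `f : G → A_e`, `g : H → B_e`, the finitely
supported function `(r, s) ↦ f(r) ⊗ g(s)` from `G × H` to `C_e`. -/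
def tensorFun {A : FellBundle.{u, v} G} {B : FellBundle.{u', v'} H}
    {α : CStarNorm (A.algTensor B)} (C : α.Completion) (f : G →₀ A.fiber 1) (g : H →₀ B.fiber 1) :
    G × H →₀ C.bundle.fiber 1 :=
  Finsupp.onFinset (f.support ×ˢ g.support)
    (fun p => C.ι (t := (1 : G × H)) (f p.1 ⊗ₜ[ℂ] g p.2)) (by
      intro p hp
      rw [Finset.mem_product, Finsupp.mem_support_iff, Finsupp.mem_support_iff]
      refine ⟨fun h => hp ?_, fun h => hp ?_⟩
      · rw [h, TensorProduct.zero_tmul]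
        exact map_zero C.ι
      · rw [h, TensorProduct.tmul_zero]
        exact map_zero C.ι)

end FellBundle

end

noncomputable section

/-! ### Left actions of `C*`-algebras on semi-inner product modules -/

/-! For a finitely supported `a : G → B_e`, the maps `b ↦ ∑ r, a(tr)* b a(r)` on the fibers
(`compression`) carry both parts of the theorem.

Tensor nets: the compression by `f ⊗ g` sends `x ⊗ y` to the tensor product of the compressions of
`x` and `y`. Any C*-norm on `A ⊙ B` satisfies `‖x ⊗ y‖ ≤ ‖x‖ ‖y‖` (`norm_tmul_le`), so `⊗` is
jointly continuous and the net converges on elementary tensors, hence on `A ⊙ B`. A Cauchy-Schwarz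
argument bounds the compression by `‖∑ a(r)* a(r)‖` (`norm_compression_le`), so these maps are
uniformly bounded along the net and convergence extends from the dense algebraic tensor product to
its completion.

Amenability: compare the norms of the two components on the *-algebra spanned by the pairs `(π_u(b),
Λ(b))`. The reduced norm is at most the universal one (`norm_snd_le_norm_fst`), because each
positive functional on `B_e` turns `ℓ²(B)` into a Hilbert space representation and such functionals
detect the order of `B_e`. Conversely, let `π` be any representation on `H` and consider `π ⊗ λ` on
`ℓ²(G, H)`. On the vectors `s ↦ π(a(s)) h` it is bounded by the reduced norm, by a form of Fell's
absorption principle (`norm_evalTensorRegular_le`), and its matrix coefficients there are `⟨k,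
π(compression of b) h⟩`. In the limit along an approximating net the universal norm is at most `m`
times the reduced norm (`IsApproximatingNet.norm_fst_le`). Equivalence of the norms suffices: the
closure of the algebra of pairs is then the graph of a bijection from `C*(B)` to `C*_r(B)`. -/

/-- With a unit one would take `d = m - (m² - c)^(1/2)`, so that `(m - d)² = m² - c`. The function
defining `d` vanishes at `0`, so `d` stays in the algebra even without a unit. -/
lemma exists_isSelfAdjoint_mul_self_eq {D : Type*} [NonUnitalCStarAlgebra D] {c : D}
    (hc : IsSelfAdjoint c) {m : ℝ} (h0 : 0 ≤ m) (hm : ‖c‖ ≤ m ^ 2) :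
    ∃ d : D, star d = d ∧ d * d = (2 * m) • d - c := by
  let f : ℝ → ℝ := fun y => m - √(m ^ 2 - y)
  have hf0 : f 0 = 0 := by simp [f, Real.sqrt_sq h0]
  have hfc : Continuous f := by fun_prop
  refine ⟨cfcₙ f c, cfcₙ_predicate f c, ?_⟩
  have e : (2 * m) • cfcₙ f c - c = cfcₙ (fun y => (2 * m) • f y) c - cfcₙ (fun y : ℝ => y) c := by
    rw [cfcₙ_id' ℝ c, cfcₙ_smul (2 * m) f c]
  rw [e, ← cfcₙ_mul f f c, ← cfcₙ_sub (fun y => (2 * m) • f y) (fun y => y) c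
    (by fun_prop) (by simp [hf0])]
  refine cfcₙ_congr fun y hy => ?_
  have hy' : y ≤ m ^ 2 := by
    have hy2 := norm_apply_le_norm_cfcₙ (fun y : ℝ => y) c hy
    rw [cfcₙ_id' ℝ c] at hy2
    exact (le_abs_self y).trans (hy2.trans hm)
  have hs := Real.mul_self_sqrt (sub_nonneg.2 hy')
  simp only [f, smul_eq_mul]
  linear_combination hs

/-- If a `C*`-algebra `D` acts by adjointable operators on a semi-inner product module over a
`C*`-algebra, then each element `a` acts with norm at most `‖a‖`. -/
lemma form_action_self_le {D E X : Type*} [NonUnitalCStarAlgebra D] [AddCommGroup E] [Module ℂ E]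
    [NonUnitalCStarAlgebra X] [PartialOrder X] [StarOrderedRing X]
    (P : E →ₗ⋆[ℂ] E →ₗ[ℂ] X) (hP : ∀ z, 0 ≤ P z z) (L : D →ₗ[ℂ] E →ₗ[ℂ] E)
    (hmul : ∀ a b z, L (a * b) z = L a (L b z)) (hL : ∀ a z w, P (L a z) w = P z (L (star a) w))
    (a : D) (z : E) : P (L a z) (L a z) ≤ ‖a‖ ^ 2 • P z z := by
  obtain ⟨d, hd, hdd⟩ := exists_isSelfAdjoint_mul_self_eq (IsSelfAdjoint.star_mul_self a)
    (norm_nonneg a) (by rw [CStarRing.norm_star_mul_self, pow_two])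
  have e1 : P (L a z) (L a z) = P z (L (star a * a) z) := by rw [hL, hmul]
  have e2 : ∀ w, P (L d z) w = P z (L d w) := fun w => by rw [hL, hd]
  have e3 : L d (L d z) = (2 * ‖a‖) • L d z - L (star a * a) z := by
    rw [← hmul, hdd, map_sub, LinearMap.sub_apply, ← Complex.coe_smul, map_smul,
      LinearMap.smul_apply, Complex.coe_smul]
  -- `d` acts symmetrically, so this form equals `⟨z, (‖a‖ - d)² z⟩`, which is `‖a‖² ⟨z, z⟩ - ⟨a z,
  -- a z⟩` by the choice of `d`.
  have key := hP (‖a‖ • z - L d z)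
  have e4 : P (‖a‖ • z - L d z) (‖a‖ • z - L d z)
      = ‖a‖ ^ 2 • P z z - P z (L (star a * a) z) := by
    simp only [← Complex.coe_smul] at e3 ⊢
    simp only [map_sub, LinearMap.sub_apply, map_smul, LinearMap.map_smulₛₗ, LinearMap.smul_apply,
      e2, e3, Complex.conj_ofReal]
    push_cast
    module
  rw [e4] at key
  rw [e1]
  exact sub_nonneg.1 key

/-! ### C*-norms on algebraic tensor products are subcross -/

namespace FellBundle

/-- `ip` places `c*` in the fiber over `1⁻¹`, the product of `B_e` places it over `1`. Generalizing
the index removes the mismatch. -/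
lemma ip_self_unit {G : Type u} [Group G] (B : FellBundle.{u, v} G) (c : B.fiber 1) : B.ip c c = Star.star c * c := by
  have : ∀ {s : G} (hs : (1 : G)⁻¹ = s) (h' : s * 1 = 1),
      B.mul h' (B.star hs c) c = Star.star c * c := by
    intro s hs h'
    obtain rfl : s = 1 := by rw [← hs, inv_one]
    rfl
  exact this rfl _

section Tensor

variable {G : Type u} [Group G] {H : Type u'} [Group H] {A : FellBundle.{u, v} G}
  {B : FellBundle.{u', v'} H} {α : CStarNorm (A.algTensor B)} (C : α.Completion)

lemma ip_ι (p : G × H) (z w : (A.algTensor B).fiber p) :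
    C.bundle.ip (C.ι z) (C.ι w)
      = C.ι ((A.algTensor B).mul (inv_mul_cancel p) ((A.algTensor B).star rfl z) w) := by
  rw [ip_apply, C.map_mul, C.map_star]

/-- The `C_e`-valued form `⟨z, w⟩ = z* w` on the fibers of the algebraic tensor product. -/
def tensorForm (p : G × H) : (A.algTensor B).fiber p →ₗ⋆[ℂ] (A.algTensor B).fiber p →ₗ[ℂ]
    C.bundle.fiber 1 :=
  (LinearMap.lcomp ℂ _ (C.ι (t := p))).comp ((C.bundle.ip (t := p)).comp (C.ι (t := p)))

lemma tensorForm_apply (p : G × H) (z w : (A.algTensor B).fiber p) :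
    tensorForm C p z w = C.bundle.ip (C.ι z) (C.ι w) := rfl

/-- The element `a ⊗ b` of a tensor product of Fell bundles. -/
def tmul {t : G} {s : H} (a : A.fiber t) (b : B.fiber s) : C.bundle.fiber (t, s) :=
  C.ι (t := (t, s)) (a ⊗ₜ[ℂ] b)

lemma mul_tmul {t t' t'' : G} {s s' s'' : H} (h : (t, s) * (t', s') = (t'', s''))
    (h₁ : t * t' = t'') (h₂ : s * s' = s'') (a : A.fiber t) (b : B.fiber s) (a' : A.fiber t')
    (b' : B.fiber s') :
    C.bundle.mul h (tmul C a b) (tmul C a' b') = tmul C (A.mul h₁ a a') (B.mul h₂ b b') :=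
  (C.map_mul h _ _).symm

lemma star_tmul {t t' : G} {s s' : H} (h : (t, s)⁻¹ = (t', s')) (h₁ : t⁻¹ = t') (h₂ : s⁻¹ = s')
    (a : A.fiber t) (b : B.fiber s) :
    C.bundle.star h (tmul C a b) = tmul C (A.star h₁ a) (B.star h₂ b) :=
  (C.map_star h _).symm

/-- This serves operators such as `a ⊗ 1` and `1 ⊗ b`, which need not belong to the bundle when the
unit fibers have no unit and are given only on the algebraic fibers. -/
lemma norm_ι_le_of_form {D : Type*} [NonUnitalCStarAlgebra D] {p : G × H}
    (L : D →ₗ[ℂ] (A.algTensor B).fiber p →ₗ[ℂ] (A.algTensor B).fiber p)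
    (hmul : ∀ a b z, L (a * b) z = L a (L b z))
    (hL : ∀ a z w, tensorForm C p (L a z) w = tensorForm C p z (L (Star.star a) w))
    (a : D) (z : (A.algTensor B).fiber p) : ‖C.ι (L a z)‖ ≤ ‖a‖ * ‖C.ι z‖ := by
  have h := CStarAlgebra.norm_le_norm_of_nonneg_of_le
    (by rw [tensorForm_apply]; exact C.bundle.ip_self_nonneg _)
    (form_action_self_le (tensorForm C p) (fun z => C.bundle.ip_self_nonneg _) L hmul hL a z)
  rw [norm_smul, tensorForm_apply, norm_ip_self, tensorForm_apply, norm_ip_self,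
    Real.norm_of_nonneg (sq_nonneg _), ← mul_pow] at h
  exact le_of_sq_le_sq h (by positivity)

lemma norm_ι_left_mul_le (p : G × H) (a : A.fiber 1) (z : (A.algTensor B).fiber p) :
    ‖C.ι (t := p) (TensorProduct.map (A.mul (one_mul p.1) a) LinearMap.id z)‖
      ≤ ‖a‖ * ‖C.ι z‖ := by
  refine norm_ι_le_of_form C ((TensorProduct.mapBilinear (RingHom.id ℂ) _ _ _ _).flip
    LinearMap.id ∘ₗ A.mul (one_mul p.1)) ?_ ?_ a z
  · intro a b (z : A.fiber p.1 ⊗[ℂ] B.fiber p.2)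
    change TensorProduct.map _ _ z = TensorProduct.map _ _ (TensorProduct.map _ _ z)
    induction z with
    | zero => simp
    | add x y hx hy => simp only [map_add, hx, hy]
    | tmul x y =>
      simp only [TensorProduct.map_tmul]
      rw [unit_mul_def, A.mul_assoc _ _ (one_mul _) (one_mul _)]
      rfl
  · intro a (z : A.fiber p.1 ⊗[ℂ] B.fiber p.2) (w : A.fiber p.1 ⊗[ℂ] B.fiber p.2)
    refine (ip_ι C p _ w).trans (Eq.trans (congrArg C.ι ?_) (ip_ι C p z _).symm)
    change TensorProduct.map₂ (A.mul (inv_mul_cancel p.1)) (B.mul (inv_mul_cancel p.2))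
        (TensorProduct.map (A.star rfl) (B.star rfl) (TensorProduct.map _ _ z)) w
      = TensorProduct.map₂ (A.mul (inv_mul_cancel p.1)) (B.mul (inv_mul_cancel p.2))
        (TensorProduct.map (A.star rfl) (B.star rfl) z) (TensorProduct.map _ _ w)
    induction z with
    | zero => simp
    | add x y hx hy => simp only [map_add, LinearMap.add_apply, hx, hy]
    | tmul x y =>
      induction w with
      | zero => simp
      | add x y hx hy => simp only [map_add, hx, hy]
      | tmul x' y' =>
        simp only [TensorProduct.map_tmul, TensorProduct.map₂_apply_tmul, LinearMap.id_apply]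
        rw [A.star_mul (one_mul p.1) rfl inv_one rfl (mul_one _), A.mul_assoc]
        rfl

lemma norm_ι_right_mul_le (p : G × H) (b : B.fiber 1) (z : (A.algTensor B).fiber p) :
    ‖C.ι (t := p) (TensorProduct.map LinearMap.id (B.mul (one_mul p.2) b) z)‖
      ≤ ‖b‖ * ‖C.ι z‖ := by
  refine norm_ι_le_of_form C ((TensorProduct.mapBilinear (RingHom.id ℂ) _ _ _ _)
    LinearMap.id ∘ₗ B.mul (one_mul p.2)) ?_ ?_ b z
  · intro a b (z : A.fiber p.1 ⊗[ℂ] B.fiber p.2)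
    change TensorProduct.map _ _ z = TensorProduct.map _ _ (TensorProduct.map _ _ z)
    induction z with
    | zero => simp
    | add x y hx hy => simp only [map_add, hx, hy]
    | tmul x y =>
      simp only [TensorProduct.map_tmul]
      rw [unit_mul_def, B.mul_assoc _ _ (one_mul _) (one_mul _)]
      rfl
  · intro a (z : A.fiber p.1 ⊗[ℂ] B.fiber p.2) (w : A.fiber p.1 ⊗[ℂ] B.fiber p.2)
    refine (ip_ι C p _ w).trans (Eq.trans (congrArg C.ι ?_) (ip_ι C p z _).symm)
    change TensorProduct.map₂ (A.mul (inv_mul_cancel p.1)) (B.mul (inv_mul_cancel p.2))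
        (TensorProduct.map (A.star rfl) (B.star rfl) (TensorProduct.map _ _ z)) w
      = TensorProduct.map₂ (A.mul (inv_mul_cancel p.1)) (B.mul (inv_mul_cancel p.2))
        (TensorProduct.map (A.star rfl) (B.star rfl) z) (TensorProduct.map _ _ w)
    induction z with
    | zero => simp
    | add x y hx hy => simp only [map_add, LinearMap.add_apply, hx, hy]
    | tmul x y =>
      induction w with
      | zero => simp
      | add x y hx hy => simp only [map_add, hx, hy]
      | tmul x' y' =>
        simp only [TensorProduct.map_tmul, TensorProduct.map₂_apply_tmul, LinearMap.id_apply]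
        rw [B.star_mul (one_mul p.2) rfl inv_one rfl (mul_one _), B.mul_assoc]
        rfl

/-- For `x = a ⊗ b` one has `x x* = (a ⊗ 1)(1 ⊗ b) x*`, and the two factors act with norms at most
`‖a‖` and `‖b‖`. Hence `‖x‖² ≤ ‖a‖ ‖b‖ ‖x‖`. -/
lemma norm_tmul_unit_le (a : A.fiber 1) (b : B.fiber 1) :
    ‖(tmul C a b : C.bundle.fiber (1 : G × H))‖ ≤ ‖a‖ * ‖b‖ := by
  set x : C.bundle.fiber (1 : G × H) := tmul C a b with hx
  have h1 : x * Star.star x = C.ι (t := (1 : G × H)) (TensorProduct.map (A.mul (one_mul 1) a)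
      LinearMap.id (TensorProduct.map LinearMap.id (B.mul (one_mul 1) b)
        (A.star inv_one a ⊗ₜ[ℂ] B.star inv_one b))) := by
    rw [unit_mul_def, unit_star_def, hx]
    erw [star_tmul C _ inv_one inv_one, mul_tmul C _ (one_mul 1) (one_mul 1)]
    rfl
  have h2 : ‖C.ι (t := (1 : G × H)) (A.star inv_one a ⊗ₜ[ℂ] B.star inv_one b)‖ = ‖x‖ := by
    rw [← C.bundle.norm_star inv_one x, hx]
    erw [star_tmul C _ inv_one inv_one]
    rfl
  have h3 : ‖x * Star.star x‖ = ‖x‖ ^ 2 := by rw [CStarRing.norm_self_mul_star, pow_two]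
  rw [h1] at h3
  have h4 : ‖x‖ ^ 2 ≤ ‖a‖ * (‖b‖ * ‖x‖) := by
    rw [← h3, ← h2]
    refine (norm_ι_left_mul_le C 1 a _).trans ?_
    gcongr
    exact norm_ι_right_mul_le C 1 b _
  rcases (norm_nonneg x).eq_or_lt with h0 | h0
  · rw [← h0]; positivity
  · nlinarith

/-- Every `C*`-norm on the tensor product is subcross. -/
lemma norm_tmul_le {t : G} {s : H} (a : A.fiber t) (b : B.fiber s) :
    ‖tmul C a b‖ ≤ ‖a‖ * ‖b‖ := by
  -- `(a ⊗ b)* (a ⊗ b) = a* a ⊗ b* b` reduces the estimate to the unit fibers.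
  have h : C.bundle.ip (tmul C a b) (tmul C a b) = (tmul C (A.ip a a) (B.ip b b) :) := by
    rw [ip_apply]
    erw [star_tmul C _ rfl rfl, mul_tmul C _ (inv_mul_cancel t) (inv_mul_cancel s)]
    rfl
  have h2 := norm_tmul_unit_le C (A.ip a a) (B.ip b b)
  rw [← h, norm_ip_self, norm_ip_self, norm_ip_self, ← mul_pow] at h2
  exact le_of_sq_le_sq h2 (by positivity)

end Tensor

/-! ### The Cauchy-Schwarz inequality and the norm of compressions -/

section CauchySchwarz

variable {G : Type u} [Group G] (B : FellBundle.{u, v} G)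

/-- Write `p` as the square of its positive root `q`: the left side is `⟨q x, q x⟩`, and `‖q‖² =
‖p‖`. -/
lemma ip_mul_nonneg_le {t : G} {p : B.fiber 1} (hp : 0 ≤ p) (x : B.fiber t) :
    B.ip x (B.mul (one_mul t) p x) ≤ ‖p‖ • B.ip x x := by
  have h1 : CFC.sqrt p * CFC.sqrt p = p := CFC.sqrt_mul_sqrt_self p hp
  have h2 : Star.star (CFC.sqrt p) = CFC.sqrt p := (CFC.sqrt_nonneg p).isSelfAdjoint
  have h3 : ‖CFC.sqrt p‖ ^ 2 = ‖p‖ := by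
    rw [pow_two, ← CStarRing.norm_star_mul_self, h2, h1]
  have h := B.ip_mul_self_le (one_mul t) (CFC.sqrt p) x
  rw [B.ip_mul_left (one_mul t) inv_one (one_mul t), ← unit_star_def, h2, h3,
    ← B.mul_assoc (one_mul 1) (one_mul t), ← unit_mul_def, h1] at h
  exact h

/-- The Cauchy-Schwarz inequality for finite families. -/
lemma norm_sq_sum_star_mul_le {ι : Type*} (F : Finset ι) {t : G} (x : ι → B.fiber 1)
    (z : ι → B.fiber t) {m : ℝ} (hm : 0 < m) (hx : ‖∑ i ∈ F, Star.star (x i) * x i‖ ≤ m) :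
    ‖∑ i ∈ F, B.mul (one_mul t) (Star.star (x i)) (z i)‖ ^ 2
      ≤ m * ‖∑ i ∈ F, B.ip (z i) (z i)‖ := by
  set s := ∑ i ∈ F, B.mul (one_mul t) (Star.star (x i)) (z i) with hs
  set p := ∑ i ∈ F, Star.star (x i) * x i with hp
  have hp0 : 0 ≤ p := Finset.sum_nonneg fun i _ => star_mul_self_nonneg _
  have e1 : ∀ i, B.ip (B.mul (one_mul t) (x i) s) (z i)
      = B.ip s (B.mul (one_mul t) (Star.star (x i)) (z i)) := fun i => by
    rw [B.ip_mul_left (one_mul t) inv_one (one_mul t), unit_star_def]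
  have e2 : ∀ i, B.ip (z i) (B.mul (one_mul t) (x i) s)
      = B.ip (B.mul (one_mul t) (Star.star (x i)) (z i)) s := fun i => by
    rw [← star_ip, e1, star_ip]
  have e3 : ∀ i, B.ip (B.mul (one_mul t) (x i) s) (B.mul (one_mul t) (x i) s)
      = B.ip s (B.mul (one_mul t) (Star.star (x i) * x i) s) := fun i => by
    rw [B.ip_mul_left (one_mul t) inv_one (one_mul t), ← unit_star_def, unit_mul_def,
      B.mul_assoc (one_mul 1) (one_mul t) (one_mul t) (one_mul t)]
  -- The usual completion of the square, with `x i` acting on the total sum `s`. It expands to `m² ∑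
  -- ⟨z i, z i⟩ - 2m ⟨s, s⟩ + ⟨s, p s⟩`, and `⟨s, p s⟩ ≤ m ⟨s, s⟩` leaves `m ⟨s, s⟩ ≤ m² ∑ ⟨z i, z
  -- i⟩`.
  have key : 0 ≤ ∑ i ∈ F, B.ip ((m : ℂ) • z i - B.mul (one_mul t) (x i) s)
      ((m : ℂ) • z i - B.mul (one_mul t) (x i) s) :=
    Finset.sum_nonneg fun i _ => B.ip_self_nonneg _
  have e4 : ∑ i ∈ F, B.ip ((m : ℂ) • z i - B.mul (one_mul t) (x i) s)
        ((m : ℂ) • z i - B.mul (one_mul t) (x i) s)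
      = ((m : ℂ) * m) • ∑ i ∈ F, B.ip (z i) (z i) - (2 * m : ℂ) • B.ip s s
        + B.ip s (B.mul (one_mul t) p s) := by
    have e5 : ∀ i, B.ip ((m : ℂ) • z i - B.mul (one_mul t) (x i) s)
        ((m : ℂ) • z i - B.mul (one_mul t) (x i) s)
        = ((m : ℂ) * m) • B.ip (z i) (z i)
          - (m : ℂ) • B.ip (B.mul (one_mul t) (Star.star (x i)) (z i)) s
          - (m : ℂ) • B.ip s (B.mul (one_mul t) (Star.star (x i)) (z i))
          + B.ip s (B.mul (one_mul t) (Star.star (x i) * x i) s) := fun i => by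
      simp only [map_sub, LinearMap.sub_apply, map_smul, LinearMap.map_smulₛₗ,
        LinearMap.smul_apply, e1, e2, e3, Complex.conj_ofReal]
      module
    rw [Finset.sum_congr rfl fun i _ => e5 i, Finset.sum_add_distrib, Finset.sum_sub_distrib,
      Finset.sum_sub_distrib, ← Finset.smul_sum, ← Finset.smul_sum, ← Finset.smul_sum]
    have f1 : ∑ i ∈ F, B.ip (B.mul (one_mul t) (Star.star (x i)) (z i)) s = B.ip s s := by
      rw [← LinearMap.sum_apply, ← map_sum, ← hs]
    have f2 : ∑ i ∈ F, B.ip s (B.mul (one_mul t) (Star.star (x i)) (z i)) = B.ip s s := by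
      rw [← map_sum, ← hs]
    have f3 : ∑ i ∈ F, B.ip s (B.mul (one_mul t) (Star.star (x i) * x i) s)
        = B.ip s (B.mul (one_mul t) p s) := by
      rw [← map_sum, ← LinearMap.sum_apply, ← map_sum, ← hp]
    rw [f1, f2, f3]
    module
  rw [e4] at key
  have h1 : B.ip s (B.mul (one_mul t) p s) ≤ (m : ℂ) • B.ip s s := by
    rw [Complex.coe_smul]
    exact (B.ip_mul_nonneg_le hp0 s).trans (smul_le_smul_of_nonneg_right hx (B.ip_self_nonneg s))
  have h2 : (m : ℂ) • B.ip s s ≤ ((m : ℂ) * m) • ∑ i ∈ F, B.ip (z i) (z i) := by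
    have h3 := key.trans (add_le_add_right h1 _)
    rw [← sub_nonneg]
    convert h3 using 1
    module
  have h4 := CStarAlgebra.norm_le_norm_of_nonneg_of_le
    (by rw [Complex.coe_smul]; exact smul_nonneg hm.le (B.ip_self_nonneg s)) h2
  rw [norm_smul, norm_smul, norm_mul, norm_ip_self, Complex.norm_real,
    Real.norm_of_nonneg hm.le, mul_assoc] at h4
  exact le_of_mul_le_mul_left h4 hm

end CauchySchwarz

section Compression

variable {G : Type u} [Group G] (B : FellBundle.{u, v} G)

/-- The map `b ↦ ∑ r, a(tr)* b a(r)` on the fiber over `t`. -/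
def compression (a : G →₀ B.fiber 1) (t : G) : B.fiber t →ₗ[ℂ] B.fiber t :=
  ∑ r ∈ a.support, (B.mul (mul_one t)).flip (a r) ∘ₗ B.mul (one_mul t) (Star.star (a (t * r)))

lemma compression_apply (a : G →₀ B.fiber 1) (t : G) (b : B.fiber t) :
    B.compression a t b = a.sum fun r x =>
      B.mul (mul_one t) (B.mul (one_mul t) (Star.star (a (t * r))) b) x := by
  simp [compression, Finsupp.sum]

/-- After reindexing and deleting zero terms, the left side is a partial sum of the positive sum on
the right. -/
lemma sum_translate_le (a : G →₀ B.fiber 1) (t : G) (F : Finset G) :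
    ∑ r ∈ F, Star.star (a (t * r)) * a (t * r) ≤ a.sum fun _ x => Star.star x * x := by
  classical
  rw [Finsupp.sum]
  have h1 : ∑ r ∈ F, Star.star (a (t * r)) * a (t * r)
      = ∑ r ∈ F.map (Equiv.mulLeft t).toEmbedding, Star.star (a r) * a r := by
    rw [Finset.sum_map]
    rfl
  rw [h1, ← Finset.sum_filter_add_sum_filter_not _ (fun r => r ∈ a.support)]
  have h2 : ∑ r ∈ F.map (Equiv.mulLeft t).toEmbedding with r ∉ a.support,
      Star.star (a r) * a r = 0 := by
    refine Finset.sum_eq_zero fun r hr => ?_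
    rw [Finsupp.notMem_support_iff.1 (Finset.mem_filter.1 hr).2, mul_zero]
  rw [h2, add_zero]
  exact Finset.sum_le_sum_of_subset_of_nonneg (fun r hr => (Finset.mem_filter.1 hr).2)
    fun r _ _ => star_mul_self_nonneg _

/-- Pair the column `a(tr)` with the column `b a(r)` by Cauchy-Schwarz. The first contributes `m`,
the second `‖b‖² m` since `(b a(r))* (b a(r)) ≤ ‖b‖² a(r)* a(r)`. -/
lemma norm_compression_le (a : G →₀ B.fiber 1) {m : ℝ} (hm : 0 < m)
    (ha : ‖a.sum fun _ x => Star.star x * x‖ ≤ m) (t : G) (b : B.fiber t) :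
    ‖B.compression a t b‖ ≤ m * ‖b‖ := by
  have e : B.compression a t b = ∑ r ∈ a.support, B.mul (one_mul t) (Star.star (a (t * r)))
      (B.mul (mul_one t) b (a r)) := by
    rw [compression_apply, Finsupp.sum]
    exact Finset.sum_congr rfl fun r _ => B.mul_assoc _ _ _ _ _ _ _
  have h1 : ‖∑ r ∈ a.support, Star.star (a (t * r)) * a (t * r)‖ ≤ m :=
    (CStarAlgebra.norm_le_norm_of_nonneg_of_le
      (Finset.sum_nonneg fun _ _ => star_mul_self_nonneg _)
      (B.sum_translate_le a t a.support)).trans ha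
  have h2 := B.norm_sq_sum_star_mul_le a.support (fun r => a (t * r))
    (fun r => B.mul (mul_one t) b (a r)) hm h1
  have h3 : ‖∑ r ∈ a.support, B.ip (B.mul (mul_one t) b (a r)) (B.mul (mul_one t) b (a r))‖
      ≤ ‖b‖ ^ 2 * m := by
    have h4 : ∑ r ∈ a.support, B.ip (B.mul (mul_one t) b (a r)) (B.mul (mul_one t) b (a r))
        ≤ ‖b‖ ^ 2 • a.sum fun _ x => Star.star x * x := by
      rw [Finsupp.sum, Finset.smul_sum]
      refine Finset.sum_le_sum fun r _ => ?_
      have := B.ip_mul_self_le (mul_one t) b (a r)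
      rwa [ip_self_unit] at this
    have h5 := CStarAlgebra.norm_le_norm_of_nonneg_of_le
      (Finset.sum_nonneg fun _ _ => B.ip_self_nonneg _) h4
    rw [norm_smul, Real.norm_of_nonneg (sq_nonneg _)] at h5
    exact h5.trans (mul_le_mul_of_nonneg_left ha (sq_nonneg _))
  rw [e]
  refine le_of_sq_le_sq (h2.trans ?_) (by positivity)
  calc m * _ ≤ m * (‖b‖ ^ 2 * m) := by gcongr
    _ = (m * ‖b‖) ^ 2 := by ring

end Compression

/-! ### Tensor products of approximating nets -/

section Tensor

variable {G : Type u} [Group G] {H : Type u'} [Group H] {A : FellBundle.{u, v} G}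
  {B : FellBundle.{u', v'} H} {α : CStarNorm (A.algTensor B)} (C : α.Completion)

/-- The bilinear map `(a, b) ↦ a ⊗ b` into a fiber of a tensor product of Fell bundles. -/
def tmulL (t : G) (s : H) : A.fiber t →L[ℂ] B.fiber s →L[ℂ] C.bundle.fiber (t, s) :=
  LinearMap.mkContinuous₂ ((TensorProduct.mk ℂ (A.fiber t) (B.fiber s)).compr₂ (C.ι (t := (t, s))))
    1 fun a b => by rw [one_mul]; exact norm_tmul_le C a b

lemma tmulL_apply {t : G} {s : H} (a : A.fiber t) (b : B.fiber s) :
    tmulL C t s a b = tmul C a b := rfl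

lemma tmul_sum_sum {ι κ : Type*} {t : G} {s : H} (F : Finset ι) (K : Finset κ) (f : ι → A.fiber t)
    (g : κ → B.fiber s) :
    tmul C (∑ i ∈ F, f i) (∑ j ∈ K, g j) = ∑ i ∈ F, ∑ j ∈ K, tmul C (f i) (g j) := by
  simp only [← tmulL_apply, map_sum, sum_apply]
  exact Finset.sum_comm

/-- Some `f r ⊗ g s` may vanish in `C_e`, so the support can be smaller than the product of the
supports; `hφ` makes the extra terms harmless. -/
lemma tensorFun_sum {M : Type*} [AddCommMonoid M] (f : G →₀ A.fiber 1) (g : H →₀ B.fiber 1)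
    (φ : G × H → C.bundle.fiber (1 : G × H) → M) (hφ : ∀ p, φ p 0 = 0) :
    (tensorFun C f g).sum φ = ∑ r ∈ f.support, ∑ s ∈ g.support,
      φ (r, s) (tmul C (f r) (g s) : C.bundle.fiber ((1 : G), (1 : H))) := by
  rw [tensorFun, Finsupp.onFinset_sum _ hφ, Finset.sum_product]
  rfl

lemma compression_tensorFun (f : G →₀ A.fiber 1) (g : H →₀ B.fiber 1) (t : G) (s : H)
    (a : A.fiber t) (b : B.fiber s) :
    C.bundle.compression (tensorFun C f g) (t, s) (tmul C a b)
      = tmul C (A.compression f t a) (B.compression g s b) := by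
  rw [compression_apply, tensorFun_sum C f g _ (fun p => map_zero _),
    compression_apply, compression_apply, Finsupp.sum, Finsupp.sum, tmul_sum_sum]
  refine Finset.sum_congr rfl fun r _ => Finset.sum_congr rfl fun q _ => ?_
  have h1 : Star.star (tensorFun C f g ((t, s) * (r, q)))
      = (tmul C (Star.star (f (t * r))) (Star.star (g (s * q))) :
        C.bundle.fiber ((1 : G), (1 : H))) :=
    star_tmul C inv_one inv_one inv_one (f (t * r)) (g (s * q))
  rw [h1]
  refine (congrArg (fun x => C.bundle.mul (mul_one (t, s)) x _)
    (mul_tmul C (one_mul (t, s)) (one_mul t) (one_mul s) _ _ a b)).trans ?_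
  exact mul_tmul C (mul_one (t, s)) (mul_one t) (mul_one s) _ _ _ _

lemma sum_star_mul_tensorFun (f : G →₀ A.fiber 1) (g : H →₀ B.fiber 1) :
    ((tensorFun C f g).sum fun _ x => Star.star x * x)
      = (tmul C (f.sum fun _ x => Star.star x * x) (g.sum fun _ x => Star.star x * x) :
        C.bundle.fiber ((1 : G), (1 : H))) := by
  rw [tensorFun_sum C f g _ (fun p => by rw [mul_zero]), Finsupp.sum, Finsupp.sum,
    tmul_sum_sum]
  refine Finset.sum_congr rfl fun r _ => Finset.sum_congr rfl fun q _ => ?_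
  refine (congrArg (fun x => C.bundle.mul (one_mul (1 : G × H)) x _)
    (star_tmul C inv_one inv_one inv_one (f r) (g q))).trans ?_
  exact mul_tmul C (one_mul (1 : G × H)) (one_mul 1) (one_mul 1) _ _ _ _

lemma isApproximatingNet_tensorFun {I : Type w} [Preorder I] {J : Type w'} [Preorder J]
    (a : I → G →₀ A.fiber 1) (b : J → H →₀ B.fiber 1) (ha : A.IsApproximatingNet a)
    (hb : B.IsApproximatingNet b) :
    C.bundle.IsApproximatingNet (fun ij : I × J => tensorFun C (a ij.1) (b ij.2)) := by
  obtain ⟨M, hM⟩ := ha.bounded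
  obtain ⟨N, hN⟩ := hb.bounded
  -- The absolute values permit multiplying the bounds without knowing their signs, and the `1`
  -- makes the result strictly positive, as `norm_compression_le` requires.
  have hbd : ∀ ij : I × J, ‖(tensorFun C (a ij.1) (b ij.2)).sum fun _ x => Star.star x * x‖
      ≤ |M| * |N| + 1 := fun ij => by
    rw [sum_star_mul_tensorFun]
    refine (norm_tmul_le C _ _).trans ((mul_le_mul ((hM _).trans (le_abs_self M))
      ((hN _).trans (le_abs_self N)) (norm_nonneg _) (abs_nonneg _)).trans ?_)
    linarith
  refine ⟨⟨_, hbd⟩, ?_⟩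
  rintro ⟨t, s⟩ c
  simp only [← compression_apply]
  have hm : 0 < |M| * |N| + 1 := by positivity
  have hdense : ∀ z : A.fiber t ⊗[ℂ] B.fiber s, Filter.Tendsto (fun ij : I × J =>
      C.bundle.compression (tensorFun C (a ij.1) (b ij.2)) (t, s) (C.ι (t := (t, s)) z))
      Filter.atTop (nhds (C.ι (t := (t, s)) z)) := by
    intro z
    induction z with
    | zero =>
      have h0 : C.ι (t := (t, s)) (0 : A.fiber t ⊗[ℂ] B.fiber s) = 0 := map_zero (C.ι (t := (t, s)))
      simp only [h0, map_zero]
      exact tendsto_const_nhds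
    | add x y hx hy =>
      have h0 : C.ι (t := (t, s)) (x + y : A.fiber t ⊗[ℂ] B.fiber s)
        = C.ι (t := (t, s)) x + C.ι (t := (t, s)) y := map_add (C.ι (t := (t, s))) x y
      simp only [h0, map_add]
      exact hx.add hy
    | tmul x y =>
      have h1 := ha.tendsto t x
      have h2 := hb.tendsto s y
      simp only [← compression_apply] at h1 h2
      -- Joint continuity of `⊗`, a consequence of the subcross estimate, handles both limits at
      -- once.
      have h3 := ((tmulL C t s).continuous₂.tendsto (x, y)).comp
        ((h1.comp Filter.tendsto_fst).prodMk_nhds (h2.comp Filter.tendsto_snd))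
      rw [Filter.prod_atTop_atTop_eq] at h3
      refine h3.congr fun ij => ?_
      exact (compression_tensorFun C (a ij.1) (b ij.2) t s x y).symm
  rw [Metric.tendsto_nhds]
  intro ε hε
  set m := |M| * |N| + 1
  -- Replacing `c` by `z` costs `m ‖c - z‖` in the compression and `‖c - z‖` in the limit; the
  -- tolerance keeps the total below `ε / 2`.
  obtain ⟨z, hz⟩ := Metric.denseRange_iff.1 (C.dense (t, s)) c (ε / (2 * (m + 1))) (by positivity)
  filter_upwards [Metric.tendsto_nhds.1 (hdense z) (ε / 2) (by positivity)] with ij hij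
  set φ := C.bundle.compression (tensorFun C (a ij.1) (b ij.2)) (t, s)
  have h1 : ‖φ (c - C.ι z)‖ ≤ m * ‖c - C.ι z‖ :=
    C.bundle.norm_compression_le _ hm (hbd ij) _ _
  rw [dist_eq_norm] at hz hij ⊢
  have e : φ c - c = φ (c - C.ι z) + (φ (C.ι z) - C.ι z) - (c - C.ι z) := by
    rw [map_sub]
    abel
  have h2 : (m + 1) * ‖c - C.ι z‖ < ε / 2 := by
    rw [lt_div_iff₀ (by positivity)] at hz
    linarith
  rw [e]
  calc _ ≤ ‖φ (c - C.ι z)‖ + ‖φ (C.ι z) - C.ι z‖ + ‖c - C.ι z‖ :=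
        (norm_sub_le _ _).trans (add_le_add_left (norm_add_le _ _) _)
    _ < ε := by
      have hij' : ‖φ (C.ι z) - C.ι z‖ < ε / 2 := hij
      linarith

end Tensor

end FellBundle

/-! ### Completeness of `ℓ²(B)` and of its adjointable operators -/

namespace FellBundle

variable {G : Type u} [Group G] {B : FellBundle.{u, v} G}

lemma norm_ip_le {t : G} (x y : B.fiber t) : ‖B.ip x y‖ ≤ ‖x‖ * ‖y‖ := by
  rw [ip_apply]
  refine (B.norm_mul_le _ _ _).trans ?_
  rw [B.norm_star]

lemma continuous_ip_self (t : G) : Continuous fun x : B.fiber t => B.ip x x := by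
  exact (LinearMap.mkContinuous₂ (B.ip (t := t)) 1
    fun x y => by rw [one_mul]; exact norm_ip_le x y).continuous.clm_apply continuous_id

namespace L2

/-- The inner product of `ℓ²(B)` as a continuous sesquilinear map. -/
def innerL : B.L2 →L⋆[ℂ] B.L2 →L[ℂ] B.fiber 1 :=
  LinearMap.mkContinuous₂
    (LinearMap.mk₂'ₛₗ (starRingEnd ℂ) (RingHom.id ℂ) inner inner_add_left inner_smul_left
      inner_add_right inner_smul_right) 1
    fun ξ η => by rw [one_mul]; exact norm_inner_le ξ η

lemma continuous_inner : Continuous fun p : B.L2 × B.L2 => inner p.1 p.2 :=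
  ((innerL (B := B)).continuous.comp continuous_fst).clm_apply continuous_snd

lemma tendsto_inner {ι : Type*} {l : Filter ι} {f g : ι → B.L2} {ξ η : B.L2}
    (hf : Filter.Tendsto f l (nhds ξ)) (hg : Filter.Tendsto g l (nhds η)) :
    Filter.Tendsto (fun i => inner (f i) (g i)) l (nhds (inner ξ η)) :=
by
  have h1 : Filter.Tendsto (fun i => (f i, g i)) l (nhds (ξ, η)) := hf.prodMk_nhds hg
  have h2 := continuous_inner.tendsto (ξ, η)
  have h3 := h2.comp h1
  exact h3

lemma sum_ip_self_le (ξ : B.L2) (F : Finset G) : ∑ t ∈ F, B.ip (ξ t) (ξ t) ≤ inner ξ ξ :=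
  (summable_self ξ).sum_le_tsum F fun _ _ => B.ip_self_nonneg _

lemma norm_sum_ip_self_le (ξ : B.L2) (F : Finset G) :
    ‖∑ t ∈ F, B.ip (ξ t) (ξ t)‖ ≤ ‖ξ‖ ^ 2 := by
  rw [norm_sq]
  exact CStarAlgebra.norm_le_norm_of_nonneg_of_le
    (Finset.sum_nonneg fun _ _ => B.ip_self_nonneg _) (sum_ip_self_le ξ F)

lemma norm_apply_le (ξ : B.L2) (t : G) : ‖ξ t‖ ≤ ‖ξ‖ := by
  have h := norm_sum_ip_self_le ξ {t}
  rw [Finset.sum_singleton, norm_ip_self] at h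
  exact le_of_sq_le_sq h (norm_nonneg _)

instance : CompleteSpace B.L2 := by
  refine Metric.complete_of_cauchySeq_tendsto fun ξ hξ => ?_
  have h1 : ∀ t, CauchySeq fun n => ξ n t := fun t => by
    rw [Metric.cauchySeq_iff'] at hξ ⊢
    intro ε hε
    obtain ⟨N, hN⟩ := hξ ε hε
    refine ⟨N, fun n hn => lt_of_le_of_lt ?_ (hN n hn)⟩
    rw [dist_eq_norm, dist_eq_norm, ← sub_apply]
    exact norm_apply_le _ t
  choose x hx using fun t => cauchySeq_tendsto_of_complete (h1 t)
  -- The finite partial sums are bounded uniformly in `F`, and for fixed `F` the bound survives the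
  -- fiberwise limit. This gives both the summability of the limit and convergence in norm.
  have h2 : ∀ ε > 0, ∃ N, ∀ n ≥ N, ∀ F : Finset G,
      ‖∑ t ∈ F, B.ip (x t - ξ n t) (x t - ξ n t)‖ ≤ ε ^ 2 := by
    intro ε hε
    obtain ⟨N, hN⟩ := Metric.cauchySeq_iff.1 hξ ε hε
    refine ⟨N, fun n hn F => ?_⟩
    have h3 : Filter.Tendsto (fun m => ‖∑ t ∈ F, B.ip (ξ m t - ξ n t) (ξ m t - ξ n t)‖)
        Filter.atTop (nhds ‖∑ t ∈ F, B.ip (x t - ξ n t) (x t - ξ n t)‖) :=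
      (tendsto_finsetSum F fun t _ => ((continuous_ip_self t).tendsto _).comp
        ((hx t).sub_const (ξ n t))).norm
    refine le_of_tendsto h3 (Filter.eventually_atTop.2 ⟨N, fun m hm => ?_⟩)
    refine (norm_sum_ip_self_le (ξ m - ξ n) F).trans ?_
    have := hN m hm n hn
    rw [dist_eq_norm] at this
    gcongr
  have h4 : Summable fun t => B.ip (x t) (x t) := by
    rw [summable_iff_vanishing_norm]
    intro ε hε
    -- The tail of the limit is at most `2 · ε/4 + 2 · ε/8 < ε`: a tail of `ξ N` plus the error.
    obtain ⟨N, hN⟩ := h2 (√(ε / 8)) (by positivity)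
    obtain ⟨s, hs⟩ := summable_iff_vanishing_norm.1 (summable_self (ξ N)) (ε / 4) (by positivity)
    refine ⟨s, fun F hF => ?_⟩
    have h5 : ∑ t ∈ F, B.ip (x t) (x t) ≤ (2 : ℝ) • (∑ t ∈ F, B.ip (ξ N t) (ξ N t))
        + (2 : ℝ) • ∑ t ∈ F, B.ip (x t - ξ N t) (x t - ξ N t) := by
      rw [Finset.smul_sum, Finset.smul_sum, ← Finset.sum_add_distrib]
      refine Finset.sum_le_sum fun t _ => ?_
      have := B.ip_add_self_le (ξ N t) (x t - ξ N t)
      rwa [add_sub_cancel] at this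
    have h6 := CStarAlgebra.norm_le_norm_of_nonneg_of_le
      (Finset.sum_nonneg fun _ _ => B.ip_self_nonneg _) h5
    have h7 := hN N le_rfl F
    have h8 := hs F hF
    rw [Real.sq_sqrt (by positivity)] at h7
    refine (h6.trans (norm_add_le _ _)).trans_lt ?_
    rw [norm_smul, norm_smul, Real.norm_of_nonneg (by norm_num : (0 : ℝ) ≤ 2)]
    linarith
  let X : B.L2 := ⟨x, h4⟩
  refine ⟨X, ?_⟩
  rw [Metric.tendsto_atTop]
  intro ε hε
  obtain ⟨N, hN⟩ := h2 (ε / 2) (by positivity)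
  refine ⟨N, fun n hn => ?_⟩
  rw [dist_comm, dist_eq_norm]
  have h5 : ‖X - ξ n‖ ^ 2 ≤ (ε / 2) ^ 2 := by
    rw [norm_sq]
    exact le_of_tendsto (summable_self (X - ξ n)).hasSum.norm
      (Filter.Eventually.of_forall fun F => hN n hn F)
  have h6 := le_of_sq_le_sq h5 (by positivity)
  linarith

end L2

namespace adjointable

lemma norm_star_eq (T : B.adjointable) : ‖Star.star T‖ = ‖T‖ := by
  refine le_antisymm (norm_star_le T) ?_
  have h := norm_star_le (Star.star T)
  rwa [star_star] at h

/-- The involution is isometric, so the adjoints of a Cauchy sequence also converge, and their limit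
is an adjoint of the limit. -/
instance : CompleteSpace B.adjointable := by
  refine Metric.complete_of_cauchySeq_tendsto fun T hT => ?_
  have h1 : CauchySeq fun n => (T n).1 := hT.map uniformContinuous_subtype_val
  have h2 : CauchySeq fun n => (Star.star (T n)).1 := by
    have h3 : Isometry (Star.star : B.adjointable → B.adjointable) :=
      AddMonoidHomClass.isometry_of_norm (starAddEquiv : B.adjointable ≃+ B.adjointable)
        norm_star_eq
    exact (hT.map h3.uniformContinuous).map uniformContinuous_subtype_val
  obtain ⟨R, hR⟩ := cauchySeq_tendsto_of_complete h1
  obtain ⟨S, hS⟩ := cauchySeq_tendsto_of_complete h2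
  have hRS : ∀ ξ η, L2.inner (R ξ) η = L2.inner ξ (S η) := by
    intro ξ η
    have e1 : Filter.Tendsto (fun n => L2.inner ((T n).1 ξ) η) Filter.atTop
        (nhds (L2.inner (R ξ) η)) :=
      L2.tendsto_inner (((ContinuousLinearMap.apply ℂ B.L2 ξ).continuous.tendsto R).comp hR) tendsto_const_nhds
    have e2 : Filter.Tendsto (fun n => L2.inner ξ ((Star.star (T n)).1 η)) Filter.atTop
        (nhds (L2.inner ξ (S η))) :=
      L2.tendsto_inner tendsto_const_nhds (((ContinuousLinearMap.apply ℂ B.L2 η).continuous.tendsto S).comp hS)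
    refine tendsto_nhds_unique e1 (e2.congr fun n => ?_)
    exact (inner_star (T n) ξ η).symm
  refine ⟨⟨R, S, hRS⟩, ?_⟩
  rw [tendsto_subtype_rng]
  exact hR

end adjointable

end FellBundle

/-! ### Positive functionals determine the order -/

open scoped ComplexOrder in
-- By Hahn-Banach, a self-adjoint element outside the closed cone of positive elements is separated
-- from it by a real functional, which extends to a complex positive one.
lemma nonneg_of_forall_positiveLinearMap {A : Type*} [NonUnitalCStarAlgebra A] [PartialOrder A]
    [StarOrderedRing A] {a : A} (ha : IsSelfAdjoint a) (h : ∀ φ : A →ₚ[ℂ] ℂ, 0 ≤ (φ a).re) :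
    0 ≤ a := by
  by_contra hn
  obtain ⟨f, hf, hfa⟩ := (ProperCone.positive ℝ A).hyperplane_separation_point
    (x₀ := a) (by simpa using hn)
  -- Composing `f` with the real part makes it vanish on `i` times self-adjoint elements, so the
  -- complexification `x ↦ g x - i g(i x)` agrees with `f` on them.
  let g : Module.Dual ℝ A := f.toLinearMap ∘ₗ
    ((2⁻¹ : ℝ) • (LinearMap.id + (starLinearEquiv ℝ : A ≃ₗ⋆[ℝ] A).toLinearMap))
  have hg : ∀ x, g x = f ((2⁻¹ : ℝ) • (x + star x)) := fun x => rfl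
  have hg1 : ∀ x : A, IsSelfAdjoint x → g x = f x := fun x hx => by
    rw [hg, hx.star_eq, ← two_smul ℝ x, smul_smul]
    norm_num
  have hg2 : ∀ x : A, IsSelfAdjoint x → g (Complex.I • x) = 0 := fun x hx => by
    rw [hg, star_smul, hx.star_eq]
    simp
  let φ : A →ₚ[ℂ] ℂ := PositiveLinearMap.mk₀ (Module.Dual.extendRCLike g) (fun x hx => by
    rw [Module.Dual.extendRCLike_apply]
    have h2 := hg2 x (.of_nonneg hx)
    have h1 := hg1 x (.of_nonneg hx)
    have h3 : 0 ≤ f x := hf x (by simpa using hx)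
    have h4 : g ((RCLike.I : ℂ) • x) = 0 := h2
    rw [h4, h1]
    simpa using h3)
  have h5 : (φ a).re = f a := by
    have : (φ a).re = RCLike.re (Module.Dual.extendRCLike g a : ℂ) := rfl
    rw [this, Module.Dual.re_extendRCLike_apply, hg1 a ha]
  have := h φ
  rw [h5] at this
  exact absurd hfa (not_lt.2 this)

lemma NonUnitalStarAlgebra.adjoin_toSubmodule_eq_span {A : Type*} [NonUnitalRing A] [Module ℂ A]
    [IsScalarTower ℂ A A] [SMulCommClass ℂ A A] [StarRing A] [StarModule ℂ A] (S : Set A)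
    (hmul : ∀ x ∈ S, ∀ y ∈ S, x * y ∈ S) (hstar : ∀ x ∈ S, star x ∈ S) :
    (NonUnitalStarAlgebra.adjoin ℂ S).toSubmodule = Submodule.span ℂ S := by
  rw [NonUnitalStarAlgebra.adjoin_eq_span]
  congr 1
  have h : S ∪ star S = S := by
    refine Set.union_eq_self_of_subset_right fun x hx => ?_
    have := hstar _ (Set.mem_star.1 hx)
    rwa [star_star] at this
  rw [h]
  refine le_antisymm ?_ Subsemigroup.subset_closure
  exact (Subsemigroup.closure_le (S := ⟨S, fun hx hy => hmul _ hx _ hy⟩)).2 le_rfl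

namespace FellBundle

variable {G : Type u} [Group G] {B : FellBundle.{u, v} G}

/-! ### The pairs of corresponding elements of the universal and the regular representation -/

lemma mul_section_congr {s p q r : G} (hpq : p = q) (h : s * p = r) (h' : s * q = r)
    (a : B.fiber s) (x : ∀ t, B.fiber t) : B.mul h a (x p) = B.mul h' a (x q) := by
  subst hpq
  rfl

lemma regular_mul {s t p : G} (h : s * t = p) (a : B.fiber s) (b : B.fiber t) :
    B.regular (B.mul h a b) = B.regular a * B.regular b := by
  refine Subtype.ext (ContinuousLinearMap.ext fun ξ => L2.ext fun r => ?_)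
  change B.mul _ (B.mul h a b) (ξ _) = B.mul _ a (B.mul _ b (ξ _))
  have h1 : t * (t⁻¹ * (s⁻¹ * r)) = s⁻¹ * r := mul_inv_cancel_left _ _
  have h2 : p⁻¹ * r = t⁻¹ * (s⁻¹ * r) := by rw [← h]; group
  have h3 : p * (t⁻¹ * (s⁻¹ * r)) = r := by rw [← h]; group
  rw [mul_section_congr h2 _ h3]
  exact B.mul_assoc _ _ _ _ _ _ _

lemma regular_star {s t : G} (h : s⁻¹ = t) (a : B.fiber s) :
    B.regular (B.star h a) = Star.star (B.regular a) := by
  subst h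
  refine Subtype.ext ?_
  rw [adjointable.coe_star]
  exact (adjointable.adj_unique _ _ (B.inner_regularOp a)).symm

lemma universal_mul {s t p : G} (h : s * t = p) (a : B.fiber s) (b : B.fiber t) :
    B.universal (B.mul h a b) = B.universal a * B.universal b :=
  Subtype.ext (funext fun π => π.map_mul h a b)

lemma universal_star {s t : G} (h : s⁻¹ = t) (a : B.fiber s) :
    B.universal (B.star h a) = Star.star (B.universal a) :=
  Subtype.ext (funext fun π => π.map_star h a)

variable (B) in
/-- The pairs `(π_u(b), Λ(b))` for `b` in some fiber of the bundle. -/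
def pairSet : Set (B.UniversalAlgebra × B.adjointable) :=
  {p | ∃ (t : G) (b : B.fiber t), p = (B.universal b, B.regular b)}

variable (B) in
/-- The `*`-algebra generated by the pairs `(π_u(b), Λ(b))`. -/
def pairAlgebra : NonUnitalStarSubalgebra ℂ (B.UniversalAlgebra × B.adjointable) :=
  NonUnitalStarAlgebra.adjoin ℂ B.pairSet

lemma pairAlgebra_toSubmodule : B.pairAlgebra.toSubmodule = Submodule.span ℂ B.pairSet := by
  refine NonUnitalStarAlgebra.adjoin_toSubmodule_eq_span _ ?_ ?_
  · rintro _ ⟨s, a, rfl⟩ _ ⟨t, b, rfl⟩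
    exact ⟨s * t, B.mul rfl a b, by rw [universal_mul, regular_mul]; rfl⟩
  · rintro _ ⟨s, a, rfl⟩
    exact ⟨s⁻¹, B.star rfl a, by rw [universal_star, regular_star]; rfl⟩

instance instModuleUniversalAlgebra : Module ℂ B.UniversalAlgebra := inferInstance

instance instSMulUniversalAlgebra : SMul ℂ B.UniversalAlgebra :=
  instModuleUniversalAlgebra.toSMul

/-- The generating pairs are closed under products and adjoints, so their linear span is already the
algebra and only linear cases occur. -/
lemma pairAlgebra_induction {P : B.UniversalAlgebra × B.adjointable → Prop}
    (hgen : ∀ (t : G) (b : B.fiber t), P (B.universal b, B.regular b)) (hzero : P 0)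
    (hadd : ∀ x y, P x → P y → P (x + y))
    (hsmul : ∀ (z : ℂ) x y, P (x, y) → P (z • x, z • y))
    {p : B.UniversalAlgebra × B.adjointable} (hp : p ∈ B.pairAlgebra) : P p := by
  have hp' : p ∈ Submodule.span ℂ B.pairSet := by
    rw [← pairAlgebra_toSubmodule]
    exact hp
  clear hp
  induction hp' using Submodule.span_induction with
  | mem x hx =>
    obtain ⟨t, b, rfl⟩ := hx
    exact hgen t b
  | zero => exact hzero
  | add x y _ _ hx hy => exact hadd x y hx hy
  | smul z x _ hx => exact hsmul z x.1 x.2 hx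

/-! ### Representations induced from positive functionals -/

/-- The operator norm bound alone would not do for inducing: a positive functional has to be applied
to an inequality in `B_e`. -/
lemma inner_regularOp_self_le {t : G} (b : B.fiber t) (ξ : B.L2) :
    L2.inner (B.regularOp b ξ) (B.regularOp b ξ) ≤ ‖b‖ ^ 2 • L2.inner ξ ξ := by
  have hs : Summable fun s => B.ip (ξ (t⁻¹ * s)) (ξ (t⁻¹ * s)) :=
    (Equiv.mulLeft t⁻¹).summable_iff.2 (L2.summable_self ξ)
  have he : ∑' s, B.ip (ξ (t⁻¹ * s)) (ξ (t⁻¹ * s)) = L2.inner ξ ξ :=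
    (Equiv.mulLeft t⁻¹).tsum_eq fun s => B.ip (ξ s) (ξ s)
  rw [← he, ← hs.tsum_const_smul]
  exact Summable.tsum_le_tsum
    (fun s => B.ip_mul_self_le (mul_inv_cancel_left t s) b (ξ (t⁻¹ * s)))
    (L2.summable_self (B.regularOp b ξ)) (hs.const_smul _)

open scoped ComplexOrder

set_option linter.unusedVariables false in
/-- The module `ℓ²(B)` with the semi-inner product `φ(⟨ξ, η⟩)`, for a positive functional `φ`. -/
@[nolint unusedArguments]
def PreInduced (φ : B.fiber 1 →ₚ[ℂ] ℂ) : Type (max u v) := B.L2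

namespace PreInduced

variable (φ : B.fiber 1 →ₚ[ℂ] ℂ)

instance : AddCommGroup (PreInduced φ) := inferInstanceAs (AddCommGroup B.L2)
instance : Module ℂ (PreInduced φ) := inferInstanceAs (Module ℂ B.L2)

/-- The identity map from `ℓ²(B)`. -/
def of : B.L2 ≃ₗ[ℂ] PreInduced φ := LinearEquiv.refl ℂ _

/-- The semi-inner product `φ(⟨ξ, η⟩)`. -/
abbrev innerCore : PreInnerProductSpace.Core ℂ (PreInduced φ) where
  inner ξ η := φ (L2.inner ((of φ).symm ξ) ((of φ).symm η))
  conj_inner_symm ξ η := by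
    rw [← Complex.star_def, ← map_star φ, L2.star_inner]
  re_inner_nonneg ξ := (RCLike.nonneg_iff.mp (φ.map_nonneg (L2.inner_self_nonneg _))).1
  add_left ξ η ζ := by rw [map_add, L2.inner_add_left, map_add]
  smul_left ξ η z := by rw [map_smul, L2.inner_smul_left, map_smul, smul_eq_mul]

instance : SeminormedAddCommGroup (PreInduced φ) :=
  InnerProductSpace.Core.toSeminormedAddCommGroup (c := innerCore φ)

instance : InnerProductSpace ℂ (PreInduced φ) := InnerProductSpace.ofCore (innerCore φ)

lemma inner_of (ξ η : B.L2) : inner ℂ (of φ ξ) (of φ η) = φ (L2.inner ξ η) := rfl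

lemma norm_of_sq (ξ : B.L2) : ‖of φ ξ‖ ^ 2 = (φ (L2.inner ξ ξ)).re := by
  rw [← inner_of]
  exact norm_sq_eq_re_inner (𝕜 := ℂ) _

/-- The operator `Λ(b)` on the induced space. -/
def op {t : G} (b : B.fiber t) : PreInduced φ →L[ℂ] PreInduced φ :=
  ((of φ).toLinearMap ∘ₗ (B.regularOp b).toLinearMap ∘ₗ (of φ).symm.toLinearMap).mkContinuous ‖b‖
    fun x => by
      obtain ⟨ξ, rfl⟩ := (of φ).surjective x
      change ‖of φ (B.regularOp b ξ)‖ ≤ ‖b‖ * ‖of φ ξ‖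
      refine le_of_sq_le_sq ?_ (by positivity)
      rw [mul_pow, norm_of_sq, norm_of_sq]
      have h := OrderHomClass.mono φ (inner_regularOp_self_le b ξ)
      rw [← Complex.coe_smul, map_smul] at h
      have h2 := (Complex.le_def.1 h).1
      rw [smul_eq_mul, Complex.re_ofReal_mul] at h2
      exact h2

lemma op_of {t : G} (b : B.fiber t) (ξ : B.L2) : op φ b (of φ ξ) = of φ (B.regularOp b ξ) := rfl

end PreInduced

open UniformSpace Completion in
/-- The representation induced from a positive functional on the unit fiber. -/
def inducedRep (φ : B.fiber 1 →ₚ[ℂ] ℂ) : B.Rep where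
  -- The completion is Hausdorff, so it also divides out the vectors with `φ(⟨ξ, ξ⟩) = 0`.
  -- Identities are checked on the dense image of `ℓ²(B)`.
  H := UniformSpace.Completion (PreInduced φ)
  toFun {t} :=
    { toFun := fun b => (PreInduced.op φ b).completion
      map_add' := fun a b => by
        ext c
        induction c using Completion.induction_on with
        | hp => apply isClosed_eq <;> fun_prop
        | ih c =>
          obtain ⟨ξ, rfl⟩ := (PreInduced.of φ).surjective c
          have : B.regularOp (a + b) ξ = B.regularOp a ξ + B.regularOp b ξ := by
            ext s
            simp
          simp [PreInduced.op_of, this, Completion.coe_add]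
      map_smul' := fun z a => by
        ext c
        induction c using Completion.induction_on with
        | hp =>
          exact isClosed_eq (PreInduced.op φ (z • a)).completion.continuous
            (z • (PreInduced.op φ a).completion).continuous
        | ih c =>
          obtain ⟨ξ, rfl⟩ := (PreInduced.of φ).surjective c
          have : B.regularOp (z • a) ξ = z • B.regularOp a ξ := by
            ext s
            simp
          simp [PreInduced.op_of, this, Completion.coe_smul] }
  map_mul h a b := by
    ext c
    induction c using Completion.induction_on with
    | hp =>
      exact isClosed_eq (PreInduced.op φ (B.mul h a b)).completion.continuous
        ((PreInduced.op φ a).completion * (PreInduced.op φ b).completion).continuous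
    | ih c =>
      obtain ⟨ξ, rfl⟩ := (PreInduced.of φ).surjective c
      have : B.regularOp (B.mul h a b) ξ = B.regularOp a (B.regularOp b ξ) :=
        congrArg (fun T => T.1 ξ) (regular_mul h a b)
      simp [PreInduced.op_of, this]
  map_star h a := by
    subst h
    refine (ContinuousLinearMap.eq_adjoint_iff _ _).mpr fun x y => ?_
    induction x, y using Completion.induction_on₂ with
    | hp =>
      exact isClosed_eq
        (((PreInduced.op φ (B.star rfl a)).completion.continuous.comp continuous_fst).inner
          continuous_snd)
        (continuous_fst.inner ((PreInduced.op φ a).completion.continuous.comp continuous_snd))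
    | ih x y =>
      obtain ⟨ξ, rfl⟩ := (PreInduced.of φ).surjective x
      obtain ⟨η, rfl⟩ := (PreInduced.of φ).surjective y
      have h := B.inner_regularOp a η ξ
      have h2 : L2.inner (B.regularOp (B.star rfl a) ξ) η = L2.inner ξ (B.regularOp a η) := by
        rw [← L2.star_inner, ← h, L2.star_inner]
      simp [PreInduced.op_of, PreInduced.inner_of, h2]

lemma inducedRep_apply_of (φ : B.fiber 1 →ₚ[ℂ] ℂ) {p : B.UniversalAlgebra × B.adjointable}
    (hp : p ∈ B.pairAlgebra) (ξ : B.L2) :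
    p.1.1 (inducedRep φ) ((PreInduced.of φ ξ : PreInduced φ) : UniformSpace.Completion _)
      = ((PreInduced.of φ (p.2.1 ξ) : PreInduced φ) : UniformSpace.Completion _) := by
  refine pairAlgebra_induction (P := fun p : B.UniversalAlgebra × B.adjointable =>
    p.1.1 (inducedRep φ) ((PreInduced.of φ ξ : PreInduced φ) : UniformSpace.Completion _)
      = ((PreInduced.of φ (p.2.1 ξ) : PreInduced φ) : UniformSpace.Completion _)) ?_ ?_ ?_ ?_ hp
  · intro t b
    exact ContinuousLinearMap.completion_apply_coe _ _
  · rfl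
  · intro x y hx hy
    exact (congrArg₂ (· + ·) hx hy).trans (UniformSpace.Completion.coe_add _ _).symm
  · intro z x y hx
    exact (congrArg (z • ·) hx).trans (UniformSpace.Completion.coe_smul _ _).symm

/-- The reduced norm is dominated by the universal norm. -/
lemma norm_snd_le_norm_fst {p : B.UniversalAlgebra × B.adjointable} (hp : p ∈ B.pairAlgebra) :
    ‖p.2‖ ≤ ‖p.1‖ := by
  refine ContinuousLinearMap.opNorm_le_bound _ (norm_nonneg _) fun ξ => ?_
  -- Tested on a positive functional `φ`, this says that the value of `p.1` at the representation
  -- induced from `φ` has norm at most `‖p.1‖`.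
  have h1 : L2.inner (p.2.1 ξ) (p.2.1 ξ) ≤ ‖p.1‖ ^ 2 • L2.inner ξ ξ := by
    rw [← sub_nonneg]
    refine nonneg_of_forall_positiveLinearMap ?_ fun φ => ?_
    · rw [IsSelfAdjoint, star_sub, star_smul, L2.star_inner, L2.star_inner, star_trivial]
    · have h2 : ‖PreInduced.of φ (p.2.1 ξ)‖ ≤ ‖p.1‖ * ‖PreInduced.of φ ξ‖ := by
        rw [← UniformSpace.Completion.norm_coe (PreInduced.of φ (p.2.1 ξ)),
          ← UniformSpace.Completion.norm_coe (PreInduced.of φ ξ), ← inducedRep_apply_of φ hp]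
        exact (ContinuousLinearMap.le_opNorm _ _).trans
          (mul_le_mul_of_nonneg_right (lp.norm_apply_le_norm ENNReal.top_ne_zero p.1 _)
            (norm_nonneg _))
      have h3 := pow_le_pow_left₀ (norm_nonneg _) h2 2
      rw [mul_pow, PreInduced.norm_of_sq, PreInduced.norm_of_sq] at h3
      rw [map_sub, ← Complex.coe_smul, map_smul, Complex.sub_re, smul_eq_mul,
        Complex.re_ofReal_mul]
      linarith
  have h4 := CStarAlgebra.norm_le_norm_of_nonneg_of_le (L2.inner_self_nonneg _) h1
  rw [norm_smul, Real.norm_of_nonneg (sq_nonneg _), ← L2.norm_sq, ← L2.norm_sq, ← mul_pow] at h4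
  exact le_of_sq_le_sq h4 (by positivity)

end FellBundle

/-! ### A norm bound from the growth of powers -/

open scoped InnerProductSpace in
-- For self-adjoint `S`, Cauchy-Schwarz gives `‖S^k x‖² ≤ ‖S^(2k) x‖ ‖x‖`. Iterating along powers of
-- two yields `‖S x‖^(2^n) ‖x‖ ≤ c (m ‖x‖)^(2^n)`, and the constant `c` is lost on taking roots.
lemma ContinuousLinearMap.norm_apply_le_of_norm_pow_apply_le {E : Type*} [NormedAddCommGroup E]
    [InnerProductSpace ℂ E] [CompleteSpace E] {S : E →L[ℂ] E} (hS : IsSelfAdjoint S) (x : E)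
    {c m : ℝ} (hm : 0 ≤ m) (h : ∀ n, ‖(S ^ n) x‖ ≤ c * m ^ n) : ‖S x‖ ≤ m * ‖x‖ := by
  rcases (norm_nonneg x).eq_or_lt with hx | hx
  · rw [norm_eq_zero.1 hx.symm]
    simp
  have h1 : ∀ k, ‖(S ^ k) x‖ ^ 2 ≤ ‖(S ^ (2 ^ 1 * k)) x‖ * ‖x‖ := fun k => by
    have e : ⟪(S ^ k) x, (S ^ k) x⟫_ℂ = ⟪(S ^ (2 ^ 1 * k)) x, x⟫_ℂ := by
      have hk : IsSelfAdjoint (S ^ k) := hS.pow k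
      have := ContinuousLinearMap.adjoint_inner_left (S ^ k) x ((S ^ k) x)
      rw [← ContinuousLinearMap.star_eq_adjoint, hk.star_eq] at this
      rw [← this, pow_one, two_mul, pow_add]
      rfl
    have e2 := norm_inner_le_norm (𝕜 := ℂ) ((S ^ (2 ^ 1 * k)) x) x
    rw [← e, inner_self_eq_norm_sq_to_K] at e2
    simpa using e2
  have h2 : ∀ n, ‖S x‖ ^ 2 ^ n * ‖x‖ ≤ ‖(S ^ 2 ^ n) x‖ * ‖x‖ ^ 2 ^ n := fun n => by
    induction n with
    | zero => simp
    | succ n ih =>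
      have h3 := pow_le_pow_left₀ (by positivity) ih 2
      have h4 := h1 (2 ^ n)
      rw [← pow_add, add_comm 1 n] at h4
      have h5 : (‖S x‖ ^ 2 ^ (n + 1) * ‖x‖) * ‖x‖
          ≤ (‖(S ^ 2 ^ (n + 1)) x‖ * ‖x‖ ^ 2 ^ (n + 1)) * ‖x‖ := by
        calc (‖S x‖ ^ 2 ^ (n + 1) * ‖x‖) * ‖x‖ = (‖S x‖ ^ 2 ^ n * ‖x‖) ^ 2 := by
              rw [pow_succ 2 n, pow_mul]; ring
          _ ≤ (‖(S ^ 2 ^ n) x‖ * ‖x‖ ^ 2 ^ n) ^ 2 := h3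
          _ = ‖(S ^ 2 ^ n) x‖ ^ 2 * ‖x‖ ^ 2 ^ (n + 1) := by
              rw [mul_pow, pow_succ 2 n, pow_mul]
          _ ≤ (‖(S ^ 2 ^ (n + 1)) x‖ * ‖x‖) * ‖x‖ ^ 2 ^ (n + 1) := by gcongr
          _ = _ := by ring
      exact le_of_mul_le_mul_right h5 hx
  by_contra hlt
  push Not at hlt
  have hr : 0 < ‖S x‖ := lt_of_le_of_lt (by positivity) hlt
  -- If the claim fails then `q < 1`, while `‖x‖ ≤ c q^(2^n)` for all `n` forces `x = 0`.
  set q := m * ‖x‖ / ‖S x‖ with hq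
  have hq1 : q < 1 := (div_lt_one hr).2 hlt
  have hq0 : 0 ≤ q := by positivity
  have h3 : Filter.Tendsto (fun n : ℕ => c * q ^ (2 ^ n)) Filter.atTop (nhds (c * 0)) :=
    ((tendsto_pow_atTop_nhds_zero_of_lt_one hq0 hq1).comp
      (tendsto_pow_atTop_atTop_of_one_lt (by norm_num))).const_mul c
  rw [mul_zero] at h3
  have h4 : ∀ n : ℕ, ‖x‖ ≤ c * q ^ (2 ^ n) := fun n => by
    have h5 := (h2 n).trans (mul_le_mul_of_nonneg_right (h (2 ^ n)) (by positivity))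
    rw [hq, div_pow, mul_pow, ← mul_div_assoc, le_div_iff₀ (by positivity)]
    linarith
  exact absurd (ge_of_tendsto' h3 h4) (not_le.2 hx)

/-! ### Operators on `ℓ²(G, H)` -/

section Shift

variable {G H : Type*} [NormedAddCommGroup H] [InnerProductSpace ℂ H]

/-- The operator `v ↦ (s ↦ T (v (e s)))` on `ℓ²(G, H)`. -/
def lpShift (T : H →L[ℂ] H) (e : G ≃ G) : lp (fun _ : G => H) 2 →L[ℂ] lp (fun _ : G => H) 2 :=
  have hbound : ∀ (v : lp (fun _ : G => H) 2) (F : Finset G),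
      ∑ s ∈ F, ‖T (v (e s))‖ ^ (2 : ℝ≥0∞).toReal ≤ (‖T‖ * ‖v‖) ^ (2 : ℝ≥0∞).toReal := by
    intro v F
    simp only [ENNReal.toReal_ofNat, Real.rpow_two]
    calc ∑ s ∈ F, ‖T (v (e s))‖ ^ 2 ≤ ∑ s ∈ F, ‖T‖ ^ 2 * ‖v (e s)‖ ^ 2 :=
          Finset.sum_le_sum fun s _ => by
            rw [← mul_pow]
            exact pow_le_pow_left₀ (norm_nonneg _) (T.le_opNorm _) 2
      _ = ‖T‖ ^ 2 * ∑ s ∈ F.map e.toEmbedding, ‖v s‖ ^ 2 := by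
          rw [← Finset.mul_sum, Finset.sum_map]
          rfl
      _ ≤ ‖T‖ ^ 2 * ‖v‖ ^ 2 := by
          have := lp.sum_rpow_le_norm_rpow (p := 2) (by norm_num) v (F.map e.toEmbedding)
          simp only [ENNReal.toReal_ofNat, Real.rpow_two] at this
          gcongr
      _ = _ := by rw [mul_pow]
  LinearMap.mkContinuous
    { toFun := fun v => ⟨fun s => T (v (e s)), memℓp_gen' (hbound v)⟩
      map_add' := fun v w => by
        ext s
        exact map_add T _ _
      map_smul' := fun z v => by
        ext s
        exact map_smul T _ _ }
    ‖T‖ fun v => lp.norm_le_of_forall_sum_le (by norm_num) (by positivity) (hbound v)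

lemma lpShift_apply (T : H →L[ℂ] H) (e : G ≃ G) (v : lp (fun _ : G => H) 2) (s : G) :
    lpShift T e v s = T (v (e s)) := rfl

lemma norm_lpShift_le (T : H →L[ℂ] H) (e : G ≃ G) : ‖lpShift T e‖ ≤ ‖T‖ := by
  unfold lpShift
  exact LinearMap.mkContinuous_norm_le _ (norm_nonneg _) _

end Shift

/-! ### The representation `π ⊗ λ` and Fell's absorption principle -/

namespace FellBundle

variable {G : Type u} [Group G] {B : FellBundle.{u, v} G}

namespace Rep

variable (π : B.Rep)

open scoped InnerProductSpace

lemma inner_apply_apply {s t p : G} (hs : s⁻¹ * t = p) (a : B.fiber s) (b : B.fiber t)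
    (h k : π.H) : ⟪π.toFun a h, π.toFun b k⟫_ℂ = ⟪h, π.toFun (B.mul hs (B.star rfl a) b) k⟫_ℂ := by
  rw [π.map_mul, π.map_star, ContinuousLinearMap.star_eq_adjoint]
  exact (ContinuousLinearMap.adjoint_inner_right _ _ _).symm

lemma norm_sq_apply {t : G} (b : B.fiber t) (h : π.H) :
    ‖π.toFun b h‖ ^ 2 = (⟪h, π.toFun (B.ip b b) h⟫_ℂ).re := by
  rw [ip_apply, ← inner_apply_apply]
  exact norm_sq_eq_re_inner (𝕜 := ℂ) _

/-- The left side is `⟨h, π(∑ b i* b i) h⟩`, and `π` is contractive. -/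
lemma sum_norm_sq_apply_le {ι : Type*} (F : Finset ι) {t : ι → G} (b : ∀ i, B.fiber (t i))
    (h : π.H) : ∑ i ∈ F, ‖π.toFun (b i) h‖ ^ 2 ≤ ‖∑ i ∈ F, B.ip (b i) (b i)‖ * ‖h‖ ^ 2 := by
  have e : ∑ i ∈ F, ‖π.toFun (b i) h‖ ^ 2
      = (⟪h, π.toFun (∑ i ∈ F, B.ip (b i) (b i)) h⟫_ℂ).re := by
    rw [map_sum, sum_apply, inner_sum, Complex.re_sum]
    exact Finset.sum_congr rfl fun i _ => π.norm_sq_apply _ _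
  rw [e]
  refine (Complex.re_le_norm _).trans ((norm_inner_le_norm _ _).trans ?_)
  have h2 := ((π.toFun (∑ i ∈ F, B.ip (b i) (b i))).le_opNorm h).trans
    (mul_le_mul_of_nonneg_right (π.norm_le _) (norm_nonneg _))
  calc _ ≤ ‖h‖ * (‖∑ i ∈ F, B.ip (b i) (b i)‖ * ‖h‖) := by gcongr
    _ = _ := by ring

/-- The representation `π ⊗ λ` on `ℓ²(G, H)`, `((π ⊗ λ)(b) v)(s) = π(b) v(t⁻¹ s)` for `b` in the
fiber over `t`. -/
def tensorRegular : B.Rep where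
  -- This space remains in the universe of `Rep`, so elements of the universal algebra can be
  -- evaluated here.
  H := lp (fun _ : G => π.H) 2
  toFun {t} :=
    { toFun := fun b => lpShift (π.toFun b) (Equiv.mulLeft t⁻¹)
      map_add' := fun a b => by
        ext v s
        simp [lpShift_apply]
      map_smul' := fun z a => by
        ext v s
        simp [lpShift_apply] }
  map_mul {s t p} h a b := by
    ext v r
    change π.toFun (B.mul h a b) (v (p⁻¹ * r)) = π.toFun a (π.toFun b (v (t⁻¹ * (s⁻¹ * r))))
    rw [π.map_mul, ← h, mul_inv_rev, mul_assoc]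
    rfl
  map_star {s t} h a := by
    refine (ContinuousLinearMap.eq_adjoint_iff _ _).mpr fun v w => ?_
    rw [lp.inner_eq_tsum, lp.inner_eq_tsum, ← (Equiv.mulLeft s⁻¹).tsum_eq]
    refine tsum_congr fun r => ?_
    change ⟪π.toFun (B.star h a) (v (t⁻¹ * (s⁻¹ * r))), w (s⁻¹ * r)⟫_ℂ
      = ⟪v r, π.toFun a (w (s⁻¹ * r))⟫_ℂ
    have e : t⁻¹ * (s⁻¹ * r) = r := by rw [← h]; group
    rw [e, π.map_star, ContinuousLinearMap.star_eq_adjoint]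
    exact ContinuousLinearMap.adjoint_inner_left _ _ _

/-- Evaluation of elements of the universal algebra at the representation `π ⊗ λ`. -/
def evalTensorRegular : B.UniversalAlgebra →⋆ₙₐ[ℂ]
    (lp (fun _ : G => π.H) 2 →L[ℂ] lp (fun _ : G => π.H) 2) where
  toFun x := x.1 π.tensorRegular
  map_smul' _ _ := rfl
  map_zero' := rfl
  map_add' _ _ := rfl
  map_mul' _ _ := rfl
  map_star' _ := rfl

lemma evalTensorRegular_universal {t : G} (b : B.fiber t) :
    π.evalTensorRegular (B.universal b) = lpShift (π.toFun b) (Equiv.mulLeft t⁻¹) := rfl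

/-- The vector `s ↦ π(ξ(s)) h` of `ℓ²(G, H)`. -/
def orbit (h : π.H) : B.L2 →ₗ[ℂ] lp (fun _ : G => π.H) 2 where
  toFun ξ := ⟨fun s => π.toFun (ξ s) h, memℓp_gen' (C := ‖ξ‖ ^ 2 * ‖h‖ ^ 2) fun F => by
    simp only [ENNReal.toReal_ofNat, Real.rpow_two]
    refine (π.sum_norm_sq_apply_le F (fun s => ξ s) h).trans ?_
    gcongr
    exact L2.norm_sum_ip_self_le ξ F⟩
  map_add' ξ η := by
    ext s
    change π.toFun (ξ s + η s) h = π.toFun (ξ s) h + π.toFun (η s) h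
    rw [map_add]
    rfl
  map_smul' z ξ := by
    ext s
    simp

lemma norm_orbit_le (h : π.H) (ξ : B.L2) : ‖π.orbit h ξ‖ ≤ ‖ξ‖ * ‖h‖ := by
  refine lp.norm_le_of_forall_sum_le (by norm_num) (by positivity) fun F => ?_
  simp only [ENNReal.toReal_ofNat, Real.rpow_two, mul_pow]
  refine (π.sum_norm_sq_apply_le F (fun s => ξ s) h).trans ?_
  gcongr
  exact L2.norm_sum_ip_self_le ξ F

/-- The link with the reduced algebra: `ξ ↦ (s ↦ π(ξ(s)) h)` intertwines the regular representation
with `π ⊗ λ`. -/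
lemma evalTensorRegular_orbit {p : B.UniversalAlgebra × B.adjointable} (hp : p ∈ B.pairAlgebra)
    (h : π.H) (ξ : B.L2) :
    π.evalTensorRegular p.1 (π.orbit h ξ) = π.orbit h (p.2.1 ξ) := by
  refine pairAlgebra_induction (P := fun p : B.UniversalAlgebra × B.adjointable =>
    π.evalTensorRegular p.1 (π.orbit h ξ) = π.orbit h (p.2.1 ξ)) ?_ ?_ ?_ ?_ hp
  · intro t b
    ext s
    change π.toFun b (π.toFun (ξ (t⁻¹ * s)) h) = π.toFun (B.mul _ b (ξ (t⁻¹ * s))) h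
    rw [π.map_mul]
    rfl
  · exact (map_zero (π.orbit h)).symm
  · intro x y hx hy
    exact (congrArg₂ (· + ·) hx hy).trans (map_add (π.orbit h) _ _).symm
  · intro z x y hx
    exact (congrArg (z • ·) hx).trans (map_smul (π.orbit h) _ _).symm

/-- The right translation by `g` on `ℓ²(G, H)`. -/
abbrev translation (g : G) : lp (fun _ : G => π.H) 2 →L[ℂ] lp (fun _ : G => π.H) 2 :=
  lpShift (ContinuousLinearMap.id ℂ π.H) (Equiv.mulRight g)

lemma norm_translation_apply_le (g : G) (v : lp (fun _ : G => π.H) 2) :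
    ‖π.translation g v‖ ≤ ‖v‖ :=
  (ContinuousLinearMap.le_of_opNorm_le _ ((norm_lpShift_le _ _).trans
    ContinuousLinearMap.norm_id_le) v).trans_eq (one_mul _)

/-- `π ⊗ λ` translates on the left, so it commutes with right translations. This extends the link
with `ℓ²(B)` to translated orbits. -/
lemma evalTensorRegular_translation {p : B.UniversalAlgebra × B.adjointable}
    (hp : p ∈ B.pairAlgebra) (g : G) (v : lp (fun _ : G => π.H) 2) :
    π.evalTensorRegular p.1 (π.translation g v) = π.translation g (π.evalTensorRegular p.1 v) := by
  refine pairAlgebra_induction (P := fun p : B.UniversalAlgebra × B.adjointable =>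
    π.evalTensorRegular p.1 (π.translation g v)
      = π.translation g (π.evalTensorRegular p.1 v)) ?_ ?_ ?_ ?_ hp
  · intro t b
    ext s
    change π.toFun b (v (t⁻¹ * s * g)) = π.toFun b (v (t⁻¹ * (s * g)))
    rw [mul_assoc]
  · exact (map_zero (π.translation g)).symm
  · intro x y hx hy
    exact (congrArg₂ (· + ·) hx hy).trans (map_add (π.translation g) _ _).symm
  · intro z x y hx
    exact (congrArg (z • ·) hx).trans (map_smul (π.translation g) _ _).symm

/-- Fell's absorption principle, on the vectors `∑ i, R_{g i} (s ↦ π(ξ i (s)) h)`. -/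
lemma norm_evalTensorRegular_le {p : B.UniversalAlgebra × B.adjointable} (hp : p ∈ B.pairAlgebra)
    {ι : Type*} (F : Finset ι) (g : ι → G) (ξ : ι → B.L2) (h : π.H) :
    ‖π.evalTensorRegular p.1 (∑ i ∈ F, π.translation (g i) (π.orbit h (ξ i)))‖
      ≤ ‖p.2‖ * ‖∑ i ∈ F, π.translation (g i) (π.orbit h (ξ i))‖ := by
  set v := ∑ i ∈ F, π.translation (g i) (π.orbit h (ξ i)) with hv
  set T := π.evalTensorRegular p.1 with hT
  -- Passing to `p* p` gives a self-adjoint operator whose powers act on each summand through powers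
  -- of `q.2` on `ξ i`.
  set q := Star.star p * p with hq
  have hqmem : q ∈ B.pairAlgebra := mul_mem (star_mem hp) hp
  set S := π.evalTensorRegular q.1 with hS
  have hST : S = ContinuousLinearMap.adjoint T * T := by
    rw [hS, hq, Prod.fst_mul, Prod.fst_star, _root_.map_mul]
    rfl
  have hsa : IsSelfAdjoint S := by
    rw [hST, ← ContinuousLinearMap.star_eq_adjoint]
    exact IsSelfAdjoint.star_mul_self T
  have hqn : ‖q.2‖ ≤ ‖p.2‖ ^ 2 := by
    rw [hq, Prod.snd_mul, Prod.snd_star, pow_two]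
    exact (_root_.norm_mul_le _ _).trans
      (mul_le_mul_of_nonneg_right (adjointable.norm_star_eq p.2).le (norm_nonneg _))
  have hpow : ∀ (n : ℕ) (i : ι), (S ^ n) (π.translation (g i) (π.orbit h (ξ i)))
      = π.translation (g i) (π.orbit h ((q.2.1 ^ n) (ξ i))) := fun n i => by
    induction n with
    | zero => rfl
    | succ n ih =>
      rw [pow_succ', mul_apply_eq_comp, ih, hS, π.evalTensorRegular_translation hqmem,
        π.evalTensorRegular_orbit hqmem, pow_succ', mul_apply_eq_comp]
  -- The constant is the sum of the separate bounds for the summands, not `‖v‖`. It does not depend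
  -- on `n`, so the power growth lemma replaces it by `‖v‖`.
  have hbound : ∀ n, ‖(S ^ n) v‖ ≤ (∑ i ∈ F, ‖ξ i‖ * ‖h‖) * (‖p.2‖ ^ 2) ^ n := fun n => by
    rw [hv, map_sum, Finset.sum_mul]
    refine norm_sum_le_of_le F fun i _ => ?_
    rw [hpow]
    refine (π.norm_translation_apply_le _ _).trans ((π.norm_orbit_le _ _).trans ?_)
    have h1 : ‖(q.2.1 ^ n) (ξ i)‖ ≤ (‖p.2‖ ^ 2) ^ n * ‖ξ i‖ := by
      induction n with
      | zero => simp
      | succ n ih =>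
        rw [pow_succ', mul_apply_eq_comp, pow_succ', mul_assoc]
        exact (ContinuousLinearMap.le_opNorm _ _).trans
          (mul_le_mul hqn ih (norm_nonneg _) (by positivity))
    calc _ ≤ (‖p.2‖ ^ 2) ^ n * ‖ξ i‖ * ‖h‖ := by gcongr
      _ = _ := by ring
  have h1 := ContinuousLinearMap.norm_apply_le_of_norm_pow_apply_le hsa v (by positivity) hbound
  have h2 : ‖T v‖ ^ 2 ≤ ‖S v‖ * ‖v‖ := by
    have e := ContinuousLinearMap.adjoint_inner_left T v (T v)
    have e2 := norm_inner_le_norm (𝕜 := ℂ) (S v) v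
    rw [hST, mul_apply_eq_comp, e, inner_self_eq_norm_sq_to_K] at e2
    rw [hST, mul_apply_eq_comp]
    simpa using e2
  refine le_of_sq_le_sq ?_ (by positivity)
  calc _ ≤ ‖S v‖ * ‖v‖ := h2
    _ ≤ ‖p.2‖ ^ 2 * ‖v‖ * ‖v‖ := by gcongr
    _ = _ := by ring

end Rep
end FellBundle

/-! ### Coefficient vectors and the bound on the universal norm -/

namespace FellBundle

variable {G : Type u} [Group G] {B : FellBundle.{u, v} G}

open Classical in
/-- The section with value `c` at the unit and zero elsewhere. -/
def L2.unitSection (c : B.fiber 1) : B.L2 :=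
  ⟨Pi.single 1 c, summable_of_hasFiniteSupport ((Set.finite_singleton (1 : G)).subset fun t ht => by
    by_contra h
    refine ht ?_
    have h0 : (Pi.single (1 : G) c : ∀ t, B.fiber t) t = 0 := Pi.single_eq_of_ne h c
    simp only [h0, map_zero])⟩

namespace Rep

variable (π : B.Rep)

open scoped InnerProductSpace

open Classical in
lemma toFun_unitSection_apply (c : B.fiber 1) (h : π.H) (t : G) :
    π.toFun (L2.unitSection c t) h = if t = 1 then π.toFun c h else 0 := by
  split_ifs with ht
  · subst ht
    change π.toFun ((Pi.single (1 : G) c : ∀ t, B.fiber t) 1) h = _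
    rw [Pi.single_eq_same]
  · change π.toFun ((Pi.single (1 : G) c : ∀ t, B.fiber t) t) h = _
    rw [Pi.single_eq_of_ne ht, map_zero]
    rfl

/-- The vector `s ↦ π(a(s)) h` of `ℓ²(G, H)`. -/
def coefficientVector (a : G →₀ B.fiber 1) (h : π.H) : lp (fun _ : G => π.H) 2 :=
  -- `a r` lies over the unit, not over `r`, so `s ↦ a s` is not a section of the bundle. Each value
  -- is placed at the unit and moved to `r` by a right translation.
  ∑ r ∈ a.support, π.translation r⁻¹ (π.orbit h (L2.unitSection (a r)))

lemma coefficientVector_apply (a : G →₀ B.fiber 1) (h : π.H) (s : G) :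
    π.coefficientVector a h s = π.toFun (a s) h := by
  classical
  have e : ∀ r, π.translation r⁻¹ (π.orbit h (L2.unitSection (a r))) s
      = if s = r then π.toFun (a r) h else 0 := fun r => by
    have := π.toFun_unitSection_apply (a r) h (s * r⁻¹)
    simp only [mul_inv_eq_one] at this
    exact this
  rw [coefficientVector, lp.coeFn_sum, Finset.sum_apply, Finset.sum_congr rfl fun r _ => e r,
    Finset.sum_ite_eq]
  split_ifs with hs
  · rfl
  · rw [Finsupp.notMem_support_iff.1 hs, map_zero]
    rfl

lemma norm_coefficientVector_le (a : G →₀ B.fiber 1) {m : ℝ} (hm : 0 ≤ m)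
    (ha : ‖a.sum fun _ x => Star.star x * x‖ ≤ m) (h : π.H) :
    ‖π.coefficientVector a h‖ ≤ √m * ‖h‖ := by
  refine lp.norm_le_of_forall_sum_le (by norm_num) (by positivity) fun F => ?_
  simp only [ENNReal.toReal_ofNat, Real.rpow_two, mul_pow, Real.sq_sqrt hm,
    coefficientVector_apply]
  refine (π.sum_norm_sq_apply_le F (fun s => a s) h).trans ?_
  gcongr
  refine le_trans ?_ ha
  refine CStarAlgebra.norm_le_norm_of_nonneg_of_le
    (Finset.sum_nonneg fun _ _ => B.ip_self_nonneg _) ?_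
  have := B.sum_translate_le a 1 F
  simp only [one_mul] at this
  simpa only [ip_self_unit] using this

/-- Reindexing by `s = t r`, the summand is `⟨π(a(tr)) k, π(b) π(a(r)) h⟩`; moving `π(a(tr))` to the
other side produces the compression. -/
lemma inner_coefficientVector (a : G →₀ B.fiber 1) {t : G} (b : B.fiber t) (h k : π.H) :
    ⟪π.coefficientVector a k, π.evalTensorRegular (B.universal b) (π.coefficientVector a h)⟫_ℂ
      = ⟪k, π.toFun (B.compression a t b) h⟫_ℂ := by
  rw [evalTensorRegular_universal, lp.inner_eq_tsum, ← (Equiv.mulLeft t).tsum_eq]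
  have e : ∀ r, ⟪π.coefficientVector a k (t * r),
        lpShift (π.toFun b) (Equiv.mulLeft t⁻¹) (π.coefficientVector a h) (t * r)⟫_ℂ
      = ⟪k, π.toFun (B.mul (mul_one t) (B.mul (one_mul t) (Star.star (a (t * r))) b) (a r)) h⟫_ℂ :=
    fun r => by
      have e0 : lpShift (π.toFun b) (Equiv.mulLeft t⁻¹) (π.coefficientVector a h) (t * r)
          = π.toFun b (π.toFun (a r) h) := by
        change π.toFun b (π.coefficientVector a h (t⁻¹ * (t * r))) = _
        rw [inv_mul_cancel_left, coefficientVector_apply]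
      rw [e0, coefficientVector_apply, π.map_mul, π.map_mul, unit_star_def, π.map_star,
        ContinuousLinearMap.star_eq_adjoint]
      exact (ContinuousLinearMap.adjoint_inner_right _ _ _).symm
  refine (tsum_congr e).trans ?_
  rw [tsum_eq_sum (s := a.support) fun r hr => by
    rw [Finsupp.notMem_support_iff.1 hr, map_zero, map_zero, zero_apply, inner_zero_right],
    compression_apply, Finsupp.sum, map_sum, sum_apply, inner_sum]

lemma continuous_inner_toFun (t : G) (h k : π.H) :
    Continuous fun b : B.fiber t => ⟪k, π.toFun b h⟫_ℂ := by
  have h1 : Continuous fun b : B.fiber t => π.toFun b :=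
    (LinearMap.mkContinuous (π.toFun (t := t)) 1 fun b => by rw [one_mul]; exact π.norm_le b).continuous
  exact continuous_const.inner (h1.clm_apply continuous_const)

lemma tendsto_inner_coefficientVector {I : Type w} [Preorder I] {a : I → G →₀ B.fiber 1}
    (ha : B.IsApproximatingNet a) {p : B.UniversalAlgebra × B.adjointable}
    (hp : p ∈ B.pairAlgebra) (h k : π.H) :
    Filter.Tendsto (fun i => ⟪π.coefficientVector (a i) k,
      π.evalTensorRegular p.1 (π.coefficientVector (a i) h)⟫_ℂ) Filter.atTop
      (nhds ⟪k, p.1.1 π h⟫_ℂ) := by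
  refine pairAlgebra_induction (P := fun p : B.UniversalAlgebra × B.adjointable =>
    Filter.Tendsto (fun i => ⟪π.coefficientVector (a i) k,
      π.evalTensorRegular p.1 (π.coefficientVector (a i) h)⟫_ℂ) Filter.atTop
      (nhds ⟪k, p.1.1 π h⟫_ℂ)) ?_ ?_ ?_ ?_ hp
  · intro t b
    simp only [inner_coefficientVector]
    have h1 := ha.tendsto t b
    simp only [← compression_apply] at h1
    exact ((π.continuous_inner_toFun t h k).tendsto b).comp h1
  · have e1 : ∀ i, ⟪π.coefficientVector (a i) k, π.evalTensorRegular
        (0 : B.UniversalAlgebra × B.adjointable).1 (π.coefficientVector (a i) h)⟫_ℂ = 0 :=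
      fun i => inner_zero_right _
    have e2 : ⟪k, (0 : B.UniversalAlgebra × B.adjointable).1.1 π h⟫_ℂ = 0 := inner_zero_right _
    rw [e2]
    exact tendsto_const_nhds.congr fun i => (e1 i).symm
  · intro x y hx hy
    have e1 : ∀ i, ⟪π.coefficientVector (a i) k, π.evalTensorRegular (x + y).1
        (π.coefficientVector (a i) h)⟫_ℂ = ⟪π.coefficientVector (a i) k,
        π.evalTensorRegular x.1 (π.coefficientVector (a i) h)⟫_ℂ + ⟪π.coefficientVector (a i) k,
        π.evalTensorRegular y.1 (π.coefficientVector (a i) h)⟫_ℂ := fun i => inner_add_right _ _ _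
    have e2 : ⟪k, (x + y).1.1 π h⟫_ℂ = ⟪k, x.1.1 π h⟫_ℂ + ⟪k, y.1.1 π h⟫_ℂ := inner_add_right _ _ _
    rw [e2]
    exact (hx.add hy).congr fun i => (e1 i).symm
  · intro z x y hx
    have e1 : ∀ i, ⟪π.coefficientVector (a i) k, π.evalTensorRegular (z • x)
        (π.coefficientVector (a i) h)⟫_ℂ = z * ⟪π.coefficientVector (a i) k,
        π.evalTensorRegular x (π.coefficientVector (a i) h)⟫_ℂ := fun i => inner_smul_right _ _ _
    have e2 : ⟪k, (z • x).1 π h⟫_ℂ = z * ⟪k, x.1 π h⟫_ℂ := inner_smul_right _ _ _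
    change Filter.Tendsto (fun i => ⟪π.coefficientVector (a i) k, π.evalTensorRegular (z • x)
      (π.coefficientVector (a i) h)⟫_ℂ) Filter.atTop (nhds ⟪k, (z • x).1 π h⟫_ℂ)
    rw [e2]
    exact (hx.const_mul z).congr fun i => (e1 i).symm

/-- Matrix coefficients of `π` are limits of those of `π ⊗ λ` on coefficient vectors, where
absorption applies. Each of the two vectors contributes a factor `√m`. -/
lemma norm_eval_le {I : Type w} [Preorder I] [IsDirectedOrder I] [Nonempty I]
    {a : I → G →₀ B.fiber 1} (ha : B.IsApproximatingNet a) {m : ℝ} (hm : 0 ≤ m)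
    (hbd : ∀ i, ‖(a i).sum fun _ x => Star.star x * x‖ ≤ m)
    {p : B.UniversalAlgebra × B.adjointable} (hp : p ∈ B.pairAlgebra) :
    ‖p.1.1 π‖ ≤ m * ‖p.2‖ := by
  have key : ∀ h k : π.H, ‖⟪k, p.1.1 π h⟫_ℂ‖ ≤ m * ‖p.2‖ * (‖h‖ * ‖k‖) := fun h k => by
    refine le_of_tendsto (π.tendsto_inner_coefficientVector ha hp h k).norm
      (Filter.Eventually.of_forall fun i => ?_)
    have h1 := π.norm_coefficientVector_le (a i) hm (hbd i) k
    have h2 := π.norm_coefficientVector_le (a i) hm (hbd i) h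
    have h3 := π.norm_evalTensorRegular_le hp (a i).support (fun r => r⁻¹)
      (fun r => L2.unitSection (a i r)) h
    calc _ ≤ ‖π.coefficientVector (a i) k‖ * (‖p.2‖ * ‖π.coefficientVector (a i) h‖) :=
          (norm_inner_le_norm _ _).trans (mul_le_mul_of_nonneg_left h3 (norm_nonneg _))
      _ ≤ (√m * ‖k‖) * (‖p.2‖ * (√m * ‖h‖)) := by gcongr
      _ = (√m * √m) * ‖p.2‖ * (‖h‖ * ‖k‖) := by ring
      _ = _ := by rw [Real.mul_self_sqrt hm]
  refine ContinuousLinearMap.opNorm_le_bound _ (by positivity) fun h => ?_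
  have h1 := key h (p.1.1 π h)
  rw [inner_self_eq_norm_sq_to_K, norm_pow, RCLike.norm_ofReal, abs_norm, pow_two,
    ← mul_assoc] at h1
  rcases (norm_nonneg (p.1.1 π h)).eq_or_lt with h0 | h0
  · rw [← h0]
    positivity
  · exact le_of_mul_le_mul_right h1 h0

end Rep

/-- In the presence of an approximating net, the universal norm is dominated by a multiple of the
reduced norm. -/
lemma IsApproximatingNet.norm_fst_le {I : Type w} [Preorder I] [IsDirectedOrder I] [Nonempty I]
    {a : I → G →₀ B.fiber 1} (ha : B.IsApproximatingNet a) :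
    ∃ m : ℝ, 0 ≤ m ∧ ∀ p ∈ B.pairAlgebra, ‖p.1‖ ≤ m * ‖p.2‖ := by
  obtain ⟨M, hM⟩ := ha.bounded
  refine ⟨|M|, abs_nonneg _, fun p hp => ?_⟩
  exact lp.norm_le_of_forall_le (by positivity)
    fun π => π.norm_eval_le ha (abs_nonneg M) (fun i => (hM i).trans (le_abs_self M)) hp

end FellBundle

/-! ### From equivalent norms to an isomorphism of the closures -/

/-- A bounded below continuous `*`-homomorphism from the closed `*`-algebra generated by `S` maps onto
the closed `*`-algebra generated by the image of `S`. -/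
lemma NonUnitalStarAlgHom.image_topologicalClosure_adjoin {X Y : Type*} [NonUnitalNormedRing X]
    [NormedSpace ℂ X] [IsScalarTower ℂ X X] [SMulCommClass ℂ X X] [StarRing X] [StarModule ℂ X]
    [ContinuousStar X] [CompleteSpace X] [NonUnitalNormedRing Y] [NormedSpace ℂ Y]
    [IsScalarTower ℂ Y Y] [SMulCommClass ℂ Y Y] [StarRing Y] [StarModule ℂ Y] [ContinuousStar Y]
    (F : X →⋆ₙₐ[ℂ] Y) (hF : Continuous F) (S : Set X) {m : NNReal}
    (hm : ∀ x ∈ (NonUnitalStarAlgebra.adjoin ℂ S).topologicalClosure, ‖x‖ ≤ m * ‖F x‖) :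
    F '' (NonUnitalStarAlgebra.adjoin ℂ S).topologicalClosure
      = ((NonUnitalStarAlgebra.adjoin ℂ (F '' S)).topologicalClosure : Set Y) := by
  set D := NonUnitalStarAlgebra.adjoin ℂ S with hD
  have hmap : (NonUnitalStarAlgebra.adjoin ℂ (F '' S) : Set Y) = F '' D := by
    rw [← NonUnitalStarAlgHom.map_adjoin]
    rfl
  change F '' closure (D : Set X) = closure (NonUnitalStarAlgebra.adjoin ℂ (F '' S) : Set Y)
  rw [hmap]
  refine Set.Subset.antisymm (image_closure_subset_closure_image hF) ?_
  refine closure_minimal (Set.image_mono subset_closure) ?_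
  -- Being bounded below on a complete space makes the range closed, so it contains the closure of
  -- `F '' D`.
  have hanti : AntilipschitzWith m (fun x : D.topologicalClosure => F x) := by
    refine AntilipschitzWith.of_le_mul_dist fun x y => ?_
    have h := hm _ (sub_mem x.2 y.2)
    rw [map_sub] at h
    rw [Subtype.dist_eq, dist_eq_norm, dist_eq_norm]
    exact h
  have hc : IsClosed (Set.range fun x : D.topologicalClosure => F x) := by
    have : CompleteSpace D.topologicalClosure :=
      D.isClosed_topologicalClosure.completeSpace_coe
    exact hanti.isClosed_range
      ((uniformContinuous_addMonoidHom_of_continuous hF).comp uniformContinuous_subtype_val)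
  convert hc using 1
  ext y
  constructor
  · rintro ⟨x, hx, rfl⟩
    exact ⟨⟨x, hx⟩, rfl⟩
  · rintro ⟨x, rfl⟩
    exact ⟨x, x.2, rfl⟩

/-- If the norms of the two components are equivalent on the `*`-algebra generated by a set of pairs,
then the closed `*`-algebras generated by the components are isomorphic. -/
lemma exists_bijective_starAlgHom_of_norm_equivalent {X Y : Type*} [NonUnitalNormedRing X]
    [NormedSpace ℂ X] [IsScalarTower ℂ X X] [SMulCommClass ℂ X X] [StarRing X] [StarModule ℂ X]
    [ContinuousStar X] [CompleteSpace X] [NonUnitalNormedRing Y] [NormedSpace ℂ Y]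
    [IsScalarTower ℂ Y Y] [SMulCommClass ℂ Y Y] [StarRing Y] [StarModule ℂ Y] [ContinuousStar Y]
    [CompleteSpace Y] (S : Set (X × Y)) {S₁ : Set X} {S₂ : Set Y} (s₁ : Prod.fst '' S = S₁)
    (s₂ : Prod.snd '' S = S₂) {m : ℝ} (hm0 : 0 ≤ m)
    (hle : ∀ p ∈ NonUnitalStarAlgebra.adjoin ℂ S, ‖p.2‖ ≤ ‖p.1‖)
    (hm : ∀ p ∈ NonUnitalStarAlgebra.adjoin ℂ S, ‖p.1‖ ≤ m * ‖p.2‖) :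
    ∃ Λ : (NonUnitalStarAlgebra.adjoin ℂ S₁).topologicalClosure →⋆ₙₐ[ℂ]
        (NonUnitalStarAlgebra.adjoin ℂ S₂).topologicalClosure,
      (∀ x y, (x.1, y.1) ∈ S → Λ x = y) ∧ Function.Bijective Λ := by
  subst s₁ s₂
  set D := (NonUnitalStarAlgebra.adjoin ℂ S).topologicalClosure with hD
  have h1 : ∀ p ∈ D, ‖p.2‖ ≤ ‖p.1‖ := fun p hp =>
    closure_minimal (t := {p : X × Y | ‖p.2‖ ≤ ‖p.1‖}) (fun p hp => hle p hp)
      (isClosed_le continuous_snd.norm continuous_fst.norm) hp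
  have h2 : ∀ p ∈ D, ‖p.1‖ ≤ m * ‖p.2‖ := fun p hp =>
    closure_minimal (t := {p : X × Y | ‖p.1‖ ≤ m * ‖p.2‖}) (fun p hp => hm p hp)
      (isClosed_le continuous_fst.norm (continuous_const.mul continuous_snd.norm)) hp
  have r₁ := NonUnitalStarAlgHom.image_topologicalClosure_adjoin
    (NonUnitalStarAlgHom.fst ℂ X Y) continuous_fst S (m := 1) (fun p hp => by
      rw [NNReal.coe_one, one_mul, Prod.norm_def]
      exact max_le le_rfl (h1 p hp))
  have r₂ := NonUnitalStarAlgHom.image_topologicalClosure_adjoin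
    -- The product carries the maximum norm, and `m + 1` dominates both `m` and `1`.
    (NonUnitalStarAlgHom.snd ℂ X Y) continuous_snd S (m := (m + 1).toNNReal) (fun p hp => by
      rw [Real.coe_toNNReal _ (by positivity), Prod.norm_def]
      have h3 := norm_nonneg p.2
      have h4 := h2 p hp
      change max ‖p.1‖ ‖p.2‖ ≤ (m + 1) * ‖p.2‖
      exact max_le (by linarith) (by nlinarith))
  change Prod.fst '' (D : Set (X × Y))
    = ((NonUnitalStarAlgebra.adjoin ℂ (Prod.fst '' S)).topologicalClosure : Set X) at r₁
  change Prod.snd '' (D : Set (X × Y))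
    = ((NonUnitalStarAlgebra.adjoin ℂ (Prod.snd '' S)).topologicalClosure : Set Y) at r₂
  have ex : ∀ x : (NonUnitalStarAlgebra.adjoin ℂ (Prod.fst '' S)).topologicalClosure,
      ∃ p ∈ D, p.1 = x.1 := fun x => by
    have := x.2
    rw [← SetLike.mem_coe, ← r₁] at this
    exact this
  choose p hpD hp using ex
  -- `D` is the graph of a map: by `h1` the first component determines the second. All algebraic
  -- identities for `Λ` follow from this and the closure of `D` under the operations; injectivity
  -- comes from `h2` in the same way.
  have uniq : ∀ q ∈ D, ∀ q' ∈ D, q.1 = q'.1 → q.2 = q'.2 := fun q hq q' hq' h => by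
    have := h1 _ (sub_mem hq hq')
    rw [Prod.fst_sub, Prod.snd_sub, h, sub_self, norm_zero] at this
    exact sub_eq_zero.1 (norm_le_zero_iff.1 this)
  have hmem : ∀ x, (p x).2 ∈ (NonUnitalStarAlgebra.adjoin ℂ (Prod.snd '' S)).topologicalClosure :=
    fun x => by
      rw [← SetLike.mem_coe, ← r₂]
      exact ⟨_, hpD x, rfl⟩
  refine ⟨{ toFun := fun x => ⟨(p x).2, hmem x⟩
            map_smul' := fun z x => Subtype.ext ?_
            map_zero' := Subtype.ext ?_
            map_add' := fun x y => Subtype.ext ?_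
            map_mul' := fun x y => Subtype.ext ?_
            map_star' := fun x => Subtype.ext ?_ }, fun x y hxy => Subtype.ext ?_, ?_, ?_⟩
  · exact uniq _ (hpD _) (z • p x) (SMulMemClass.smul_mem z (hpD x))
      ((hp _).trans (congrArg (z • ·) (hp x)).symm)
  · exact uniq _ (hpD _) 0 (zero_mem D) (hp 0)
  · exact uniq _ (hpD _) (p x + p y) (add_mem (hpD x) (hpD y))
      ((hp _).trans (congrArg₂ (· + ·) (hp x) (hp y)).symm)
  · exact uniq _ (hpD _) (p x * p y) (mul_mem (hpD x) (hpD y))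
      ((hp _).trans (congrArg₂ (· * ·) (hp x) (hp y)).symm)
  · exact uniq _ (hpD _) (star (p x)) (star_mem (hpD x))
      ((hp _).trans (congrArg star (hp x)).symm)
  · exact uniq _ (hpD _) (x.1, y.1) (NonUnitalStarSubalgebra.le_topologicalClosure _
      (NonUnitalStarAlgebra.subset_adjoin ℂ _ hxy)) (hp _)
  · intro x y hxy
    have h : (p x).2 = (p y).2 := congrArg Subtype.val hxy
    have := h2 _ (sub_mem (hpD x) (hpD y))
    rw [Prod.fst_sub, Prod.snd_sub, h, sub_self, norm_zero, mul_zero, hp, hp] at this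
    exact Subtype.ext (sub_eq_zero.1 (norm_le_zero_iff.1 this))
  · intro y
    have hy := y.2
    rw [← SetLike.mem_coe, ← r₂] at hy
    obtain ⟨q, hq, hqy⟩ := hy
    have hq1 : q.1 ∈ (NonUnitalStarAlgebra.adjoin ℂ (Prod.fst '' S)).topologicalClosure := by
      rw [← SetLike.mem_coe, ← r₁]
      exact ⟨q, hq, rfl⟩
    refine ⟨⟨q.1, hq1⟩, Subtype.ext ?_⟩
    exact (uniq _ (hpD _) q hq (hp _)).trans hqy

/-! ### Amenability and permanence of the approximation property -/

namespace FellBundle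

variable {G : Type u} [Group G] {B : FellBundle.{u, v} G}

lemma isAmenable_of_norm_fst_le {m : ℝ} (hm0 : 0 ≤ m)
    (hm : ∀ p ∈ B.pairAlgebra, ‖p.1‖ ≤ m * ‖p.2‖) : B.IsAmenable := by
  have s₁ : Prod.fst '' B.pairSet = {x | ∃ (t : G) (b : B.fiber t), x = B.universal b} := by
    ext x
    constructor
    · rintro ⟨_, ⟨t, b, rfl⟩, rfl⟩
      exact ⟨t, b, rfl⟩
    · rintro ⟨t, b, rfl⟩
      exact ⟨_, ⟨t, b, rfl⟩, rfl⟩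
  have s₂ : Prod.snd '' B.pairSet = {x | ∃ (t : G) (b : B.fiber t), x = B.regular b} := by
    ext x
    constructor
    · rintro ⟨_, ⟨t, b, rfl⟩, rfl⟩
      exact ⟨t, b, rfl⟩
    · rintro ⟨t, b, rfl⟩
      exact ⟨_, ⟨t, b, rfl⟩, rfl⟩
  obtain ⟨Λ, hΛ, hbij⟩ := exists_bijective_starAlgHom_of_norm_equivalent B.pairSet s₁ s₂ hm0
    (fun p hp => norm_snd_le_norm_fst hp) hm
  exact ⟨Λ, fun t b => hΛ _ _ ⟨t, b, rfl⟩, hbij⟩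

/-- A Fell bundle with the approximation property is amenable. -/
lemma HasApproximationProperty.isAmenable (h : B.HasApproximationProperty) : B.IsAmenable := by
  obtain ⟨I, _, _, _, a, ha⟩ := h
  obtain ⟨m, hm0, hm⟩ := ha.norm_fst_le
  exact isAmenable_of_norm_fst_le hm0 hm

/-- The approximation property passes to tensor products. -/
lemma HasApproximationProperty.tensor {H : Type u'} [Group H] {A : FellBundle.{u, v} G}
    {B : FellBundle.{u', v'} H} {α : CStarNorm (A.algTensor B)} (C : α.Completion)
    (hA : A.HasApproximationProperty) (hB : B.HasApproximationProperty) :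
    C.bundle.HasApproximationProperty := by
  obtain ⟨I, _, _, _, a, ha⟩ := hA
  obtain ⟨J, _, _, _, b, hb⟩ := hB
  refine ⟨I × J, inferInstance, ⟨fun x y => ?_⟩, inferInstance, _,
    isApproximatingNet_tensorFun C a b ha hb⟩
  obtain ⟨i, hi, hi'⟩ := exists_ge_ge x.1 y.1
  obtain ⟨j, hj, hj'⟩ := exists_ge_ge x.2 y.2
  exact ⟨(i, j), ⟨hi, hj⟩, ⟨hi', hj'⟩⟩

end FellBundle

end

theorem mainTheorem7 {G : Type u} [Group G] {H : Type u'} [Group H]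
    (A : FellBundle.{u, v} G) (B : FellBundle.{u', v'} H)
    (α : CStarNorm (A.algTensor B)) (C : α.Completion) :
    (∀ {I : Type w} [Preorder I] [IsDirectedOrder I] [Nonempty I]
        {J : Type w'} [Preorder J] [IsDirectedOrder J] [Nonempty J]
        (a : I → G →₀ A.fiber 1) (b : J → H →₀ B.fiber 1),
        A.IsApproximatingNet a → B.IsApproximatingNet b →
        C.bundle.IsApproximatingNet
          (fun ij : I × J => FellBundle.tensorFun C (a ij.1) (b ij.2))) ∧
    (A.HasApproximationProperty → B.HasApproximationProperty →
      C.bundle.HasApproximationProperty ∧ C.bundle.IsAmenable) :=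
  ⟨fun a b ha hb => FellBundle.isApproximatingNet_tensorFun C a b ha hb,
    fun hA hB => ⟨hA.tensor C hB, (hA.tensor C hB).isAmenable⟩⟩
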